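/- For each $N$ let $N_A=N_A(N)$ and $N_D=N_D(N)$ be dimensions such that $N_D/N_A\to 1$ as $N\to\infty$, and let $X_N\in\mathbb C^{N_A}\otimes\mathbb C^N\otimes\mathbb C^N\otimes\mathbb C^{N_D}$ be a random tensor with i.i.d. standard complex Gaussian entries (density $\pi^{-1}e^{-|z|^2}$ on $\mathbb C$). Label the four tensor factors $A,B,C,D$, let $X_NX_N^*$ be the associated rank-one matrix, and set $$W_{AB}=[\mathrm{id}\otimes\mathrm{id}\otimes\mathrm{Tr}\otimes\mathrm{Tr}](X_NX_N^*),\qquad W_{AC}=[\mathrm{id}\otimes\mathrm{Tr}\otimes\mathrm{id}\otimes\mathrm{Tr}](X_NX_N^*),$$ both regarded as matrices on $\mathbb C^{N_A}\otimes\mathbb C^N$. Every word $W_{f(p)}\cdots W_{f(1)}$ with $f\in\{AB,AC\}^p$ can be written as $W_{AB}^{r_m}W_{AC}^{s_m}\cdots W_{AB}^{r_1}W_{AC}^{s_1}$ for some $m$ and vectors $r,s\in\mathbb N^m$ of non-negative integers with $p=\sum_{i=1}^m(r_i+s_i)$. For all $m$ and $r,s\in\mathbb N^m$, with $p=\sum_i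 (r_i+s_i)$, the trace of this word is integrable and $$\lim_{N\to\infty}(N_AN)^{-p-1}\,\mathbb E\operatorname{Tr}\bigl(W_{AB}^{r_m}W_{AC}^{s_m}\cdots W_{AB}^{r_1}W_{AC}^{s_1}\bigr)=\sum_{\substack{\sigma,\pi\in \mathrm{NC}(m)\\ \sigma\le\pi}}\mathrm{Cat}_\sigma(r)\,\mathrm{Cat}_{\pi^{\mathrm{Kr}}}(s)\,\mathrm{Mob}(\sigma,\pi).$$ Here $\mathrm{NC}(m)$ is the set of non-crossing partitions of $\{1,\dots,m\}$ ordered by refinement, $\mathrm{Cat}_n=\frac1{n+1}\binom{2n}{n}$, and $\mathrm{Cat}_\sigma(r)=\prod_{b\in\sigma}\mathrm{Cat}_{\sum_{i\in b}r_i}$, the product being over the blocks $b$ of $\sigma$. The Kreweras complement $\pi^{\mathrm{Kr}}$ is taken with respect to the order of the factors in the word: it is the largest $\rho\in\mathrm{NC}(m)$ such that, after placing $\rho$ on companion points $\bar 1,\dots,\bar m$, the partition $\pi\cup\bar\rho$ is non-crossing for the order $\bar 1<1<\bar 2<2<\cdots<\bar m<m$. Finally $\mathrm{Mob}$ is the Möbius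 function of the poset $\mathrm{NC}(m)$, and for $\sigma\le\pi$ it is given by $$\mathrm{Mob}(\sigma,\pi)=\prod_{b\text{ cycle of }\sigma^{-1}\pi}(-1)^{|b|-1}\mathrm{Cat}_{|b|-1},$$ where a non-crossing partition is identified with the permutation whose cycles are its blocks, each traversed in increasing order, and $|b|$ is the length of the cycle $b$ (fixed points are cycles of length 1). -/

import Mathlib

open MeasureTheory ProbabilityTheory Filter Topology

noncomputable section

namespace WishartMarginals

/-! ### The Gaussian tensor and its two marginals -/

/-- The law of a standard complex Gaussian: density `π⁻¹ exp (-|z|²)` with respect to Lebesgue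
measure on `ℂ`. -/
def stdComplexGaussian : Measure ℂ :=
  (volume : Measure ℂ).withDensity
    (fun z => ENNReal.ofReal (Real.pi⁻¹ * Real.exp (-‖z‖ ^ 2)))

/-- The index set of the canonical basis of `ℂ^a ⊗ ℂ^b ⊗ ℂ^c ⊗ ℂ^d`. -/
abbrev Idx (a b c d : ℕ) : Type := Fin a × Fin b × Fin c × Fin d

/-- `X` is a random Gaussian tensor: its entries are independent standard complex Gaussians. -/
structure IsGaussianTensor {Ω : Type*} [MeasurableSpace Ω] {a b c d : ℕ}
    (X : Ω → Idx a b c d → ℂ) (P : Measure Ω) : Prop where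
  hasLaw : ∀ i, HasLaw (fun ω => X ω i) stdComplexGaussian P
  indep : iIndepFun (fun i ω => X ω i) P

/-- The rank one matrix `X X^*`. -/
def outer {a b c d : ℕ} (X : Idx a b c d → ℂ) : Matrix (Idx a b c d) (Idx a b c d) ℂ :=
  Matrix.vecMulVec X (star X)

/-- The partial trace `id ⊗ id ⊗ Tr ⊗ Tr`. -/
def partialTraceCD {a b c d : ℕ} (M : Matrix (Idx a b c d) (Idx a b c d) ℂ) :
    Matrix (Fin a × Fin b) (Fin a × Fin b) ℂ :=
  Matrix.of fun x y => ∑ k : Fin c, ∑ l : Fin d, M (x.1, x.2, k, l) (y.1, y.2, k, l)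

/-- The partial trace `id ⊗ Tr ⊗ id ⊗ Tr`. -/
def partialTraceBD {a b c d : ℕ} (M : Matrix (Idx a b c d) (Idx a b c d) ℂ) :
    Matrix (Fin a × Fin c) (Fin a × Fin c) ℂ :=
  Matrix.of fun x y => ∑ k : Fin b, ∑ l : Fin d, M (x.1, k, x.2, l) (y.1, k, y.2, l)

/-- The marginal `W_AB`, for a tensor whose `B` and `C` factors have the same dimension `n`. -/
def WAB {a n d : ℕ} (X : Idx a n n d → ℂ) : Matrix (Fin a × Fin n) (Fin a × Fin n) ℂ :=
  partialTraceCD (outer X)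

/-- The marginal `W_AC`. -/
def WAC {a n d : ℕ} (X : Idx a n n d → ℂ) : Matrix (Fin a × Fin n) (Fin a × Fin n) ℂ :=
  partialTraceBD (outer X)

/-- The two letters `AB`, `AC`. -/
inductive Letter
  | AB
  | AC

/-- The marginal named by a letter. -/
def W {a n d : ℕ} (X : Idx a n n d → ℂ) : Letter → Matrix (Fin a × Fin n) (Fin a × Fin n) ℂ
  | .AB => WAB X
  | .AC => WAC X

/-- The word `W_{f(p)} ⋯ W_{f(2)} W_{f(1)}`, labelled from right to left. -/
def wordProd {a n d p : ℕ} (X : Idx a n n d → ℂ) (f : Fin p → Letter) :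
    Matrix (Fin a × Fin n) (Fin a × Fin n) ℂ :=
  (List.ofFn fun i => W X (f i)).reverse.prod

/-- The word `W_AB^{r_m} W_AC^{s_m} ⋯ W_AB^{r_1} W_AC^{s_1}`, labelled from right to left. -/
def powProd {a n d m : ℕ} (X : Idx a n n d → ℂ) (r s : Fin m → ℕ) :
    Matrix (Fin a × Fin n) (Fin a × Fin n) ℂ :=
  (List.ofFn fun i => WAB X ^ r i * WAC X ^ s i).reverse.prod

/-! ### Non-crossing partitions -/

/-- A relation on a linear order is non-crossing if `a < b < c < d`, `a ∼ c`, `b ∼ d` force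
`a ∼ b`. -/
def IsNonCrossingRel {α : Type*} [LinearOrder α] (R : α → α → Prop) : Prop :=
  ∀ a b c d, a < b → b < c → c < d → R a c → R b d → R a b

/-- The relation "in the same block". -/
def SameBlock {m : ℕ} (P : Finpartition (Finset.univ : Finset (Fin m))) (i j : Fin m) : Prop :=
  j ∈ P.part i

/-- The non-crossing partitions of an `m`-element chain, ordered by refinement. -/
def NC (m : ℕ) : Type :=
  {P : Finpartition (Finset.univ : Finset (Fin m)) // IsNonCrossingRel (SameBlock P)}

instance (m : ℕ) : PartialOrder (NC m) :=
  inferInstanceAs (PartialOrder {P : Finpartition (Finset.univ : Finset (Fin m)) //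
    IsNonCrossingRel (SameBlock P)})

instance (m : ℕ) : DecidableEq (NC m) := Classical.decEq _

instance (m : ℕ) : DecidableLE (NC m) := fun _ _ => Classical.propDecidable _

instance (m : ℕ) : DecidableLT (NC m) := fun _ _ => Classical.propDecidable _

instance (m : ℕ) : Fintype (NC m) :=
  haveI : Finite (NC m) := inferInstanceAs (Finite
    {P : Finpartition (Finset.univ : Finset (Fin m)) // IsNonCrossingRel (SameBlock P)})
  Fintype.ofFinite _

instance (m : ℕ) : LocallyFiniteOrder (NC m) := Fintype.toLocallyFiniteOrder

/-- The multiplicative extension of the Catalan numbers: `∏_{b ∈ σ} Cat_{∑_{i ∈ b} r_i}`. -/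
def catProd {m : ℕ} (σ : NC m) (r : Fin m → ℕ) : ℕ :=
  ∏ b ∈ σ.1.parts, catalan (∑ i ∈ b, r i)

/-- The Möbius function of the poset `NC m`. -/
def mob {m : ℕ} (σ π : NC m) : ℤ := IncidenceAlgebra.mu ℤ σ π

/-- The permutation attached to a non-crossing partition: each block becomes a cycle, traversed
in increasing order. -/
def toPerm {m : ℕ} (σ : NC m) : Equiv.Perm (Fin m) :=
  σ.1.parts.noncommProd (fun b => (b.sort (· ≤ ·)).formPerm) (by
    intro b hb c hc hbc
    refine Equiv.Perm.Disjoint.commute fun x => ?_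
    have hd : Disjoint b c := σ.1.disjoint hb hc hbc
    by_cases hx : x ∈ b
    · right
      refine List.formPerm_apply_of_notMem ?_
      simpa using Finset.disjoint_left.1 hd hx
    · left
      refine List.formPerm_apply_of_notMem ?_
      simpa using hx)

/-- `∏_b (-1)^{|b|-1} Cat_{|b|-1}` over the cycles `b` of a permutation; fixed points contribute
the factor `1` and do not appear in `cycleType`. -/
def signedCatalanProd {m : ℕ} (τ : Equiv.Perm (Fin m)) : ℤ :=
  (τ.cycleType.map fun k => (-1 : ℤ) ^ (k - 1) * (catalan (k - 1) : ℤ)).prod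

/-! ### The Kreweras complement

Each point `i` gets a companion `ī`, placed immediately before `i`, so that the `2m` points are in
the order `1̄ < 1 < 2̄ < 2 < ⋯ < m̄ < m`.  The pair `(i, true)` stands for `i` and `(i, false)` for
`ī`, ordered lexicographically. With `i` marking `W_AB^{r_i}` and `ī` marking `W_AC^{s_i}`, this is
the right-to-left order of the factors of `powProd`. -/

/-- The partition `π ∪ ρ̄` of the `2m` points. -/
def UnionRel {m : ℕ} (π ρ : NC m) (x y : Fin m ×ₗ Bool) : Prop :=
  ((ofLex x).2 = true ∧ (ofLex y).2 = true ∧ SameBlock π.1 (ofLex x).1 (ofLex y).1) ∨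
  ((ofLex x).2 = false ∧ (ofLex y).2 = false ∧ SameBlock ρ.1 (ofLex x).1 (ofLex y).1)

/-- `ī` and `j̄` are related iff they do not separate any block of `π`, that is, the set of points
`x` lying between `ī` and `j̄` is a union of blocks of `π`. -/
def krewerasSetoid {m : ℕ} (π : NC m) : Setoid (Fin m) where
  r i j := ∀ x y, SameBlock π.1 x y → (((i ≤ x) ↔ (j ≤ x)) ↔ ((i ≤ y) ↔ (j ≤ y)))
  iseqv :=
    { refl := fun i x y _ => by tauto
      symm := fun h x y hxy => by have := h x y hxy; tauto
      trans := fun h h' x y hxy => by have := h x y hxy; have := h' x y hxy; tauto }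

theorem sameBlock_refl {m : ℕ} (P : Finpartition (Finset.univ : Finset (Fin m))) (i : Fin m) :
    SameBlock P i i := P.mem_part (Finset.mem_univ i)

theorem sameBlock_symm {m : ℕ} {P : Finpartition (Finset.univ : Finset (Fin m))} {i j : Fin m}
    (h : SameBlock P i j) : SameBlock P j i := by
  unfold SameBlock at *
  rw [P.mem_part_iff_part_eq_part (Finset.mem_univ _) (Finset.mem_univ _)] at *
  exact h.symm

theorem sameBlock_trans {m : ℕ} {P : Finpartition (Finset.univ : Finset (Fin m))} {i j k : Fin m}
    (h : SameBlock P i j) (h' : SameBlock P j k) : SameBlock P i k := by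
  unfold SameBlock at *
  rw [P.mem_part_iff_part_eq_part (Finset.mem_univ _) (Finset.mem_univ _)] at *
  exact h'.trans h

open Classical in
theorem sameBlock_ofSetoid {m : ℕ} (π : NC m) (i j : Fin m) :
    SameBlock (Finpartition.ofSetoid (krewerasSetoid π)) i j ↔ krewerasSetoid π i j := by
  unfold SameBlock
  rw [Finpartition.mem_part_ofSetoid_iff_rel]

open Classical in
/-- The Kreweras complement `π^Kr`. -/
def kreweras {m : ℕ} (π : NC m) : NC m :=
  ⟨Finpartition.ofSetoid (krewerasSetoid π), by
    intro a b c d hab hbc hcd hac hbd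
    rw [sameBlock_ofSetoid] at *
    intro x y hxy
    have h1 := hac x y hxy
    have h2 := hbd x y hxy
    simp only [Fin.le_def, Fin.lt_def] at *
    omega⟩

theorem sameBlock_kreweras {m : ℕ} (π : NC m) (i j : Fin m) :
    SameBlock (kreweras π).1 i j ↔ krewerasSetoid π i j := sameBlock_ofSetoid π i j

theorem krewerasSetoid_of_union {m : ℕ} {π ρ : NC m} (h : IsNonCrossingRel (UnionRel π ρ))
    {i j x y : Fin m} (hij : SameBlock ρ.1 i j) (hxy : SameBlock π.1 x y)
    (hix : i ≤ x) (hxj : x < j) (hy : y < i ∨ j ≤ y) : False := by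
  rcases hy with hy | hy
  · have := h (toLex (y, true)) (toLex (i, false)) (toLex (x, true)) (toLex (j, false))
      (by simp [Prod.Lex.toLex_lt_toLex, hy])
      (by simp [Prod.Lex.toLex_lt_toLex, lt_or_eq_of_le hix])
      (by simp [Prod.Lex.toLex_lt_toLex, hxj])
      (Or.inl ⟨rfl, rfl, sameBlock_symm hxy⟩) (Or.inr ⟨rfl, rfl, hij⟩)
    simp [UnionRel] at this
  · have := h (toLex (i, false)) (toLex (x, true)) (toLex (j, false)) (toLex (y, true))
      (by simp [Prod.Lex.toLex_lt_toLex, lt_or_eq_of_le hix])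
      (by simp [Prod.Lex.toLex_lt_toLex, hxj])
      (by simp [Prod.Lex.toLex_lt_toLex, lt_or_eq_of_le hy])
      (Or.inr ⟨rfl, rfl, hij⟩) (Or.inl ⟨rfl, rfl, hxy⟩)
    simp [UnionRel] at this

/-- `π^Kr` is the largest `ρ` for which `π ∪ ρ̄` is non-crossing. -/
theorem isGreatest_kreweras {m : ℕ} (π : NC m) :
    IsGreatest {ρ : NC m | IsNonCrossingRel (UnionRel π ρ)} (kreweras π) := by
  constructor
  · intro a b c d hab hbc hcd hac hbd
    rw [Prod.Lex.lt_iff] at hab hbc hcd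
    unfold UnionRel at *
    rw [sameBlock_kreweras] at *
    generalize ofLex a = a at *
    generalize ofLex b = b at *
    generalize ofLex c = c at *
    generalize ofLex d = d at *
    obtain ⟨a, a'⟩ := a
    obtain ⟨b, b'⟩ := b
    obtain ⟨c, c'⟩ := c
    obtain ⟨d, d'⟩ := d
    rcases hac with ⟨rfl, rfl, hac⟩ | ⟨rfl, rfl, hac⟩ <;>
      rcases hbd with ⟨rfl, rfl, hbd⟩ | ⟨rfl, rfl, hbd⟩ <;> simp at hab hbc hcd hac hbd ⊢
    · exact π.2 a b c d hab hbc hcd hac hbd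
    · have h : ((b ≤ a) ↔ (d ≤ a)) ↔ ((b ≤ c) ↔ (d ≤ c)) := hbd a c hac
      clear hac hbd
      simp only [show ¬ (true < false) by decide, and_false, or_false] at hab hbc hcd
      grind
    · have h : ((a ≤ b) ↔ (c ≤ b)) ↔ ((a ≤ d) ↔ (c ≤ d)) := hac b d hbd
      clear hac hbd
      simp only [show ¬ (true < false) by decide, and_false, or_false] at hab hbc hcd
      grind
    · rw [← sameBlock_kreweras] at *
      exact (kreweras π).2 a b c d hab hbc hcd hac hbd
  · intro ρ hρ
    change ρ.1 ≤ (kreweras π).1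
    intro b hb
    obtain ⟨i, hi⟩ := ρ.1.nonempty_of_mem_parts hb
    refine ⟨(kreweras π).1.part i, (kreweras π).1.part_mem.2 (Finset.mem_univ i), ?_⟩
    intro j hj
    change SameBlock (kreweras π).1 i j
    rw [sameBlock_kreweras]
    have hij : SameBlock ρ.1 i j := by
      unfold SameBlock
      rw [ρ.1.part_eq_of_mem hb hi]
      exact hj
    intro x y hxy
    have h1 := @krewerasSetoid_of_union m π ρ hρ i j x y hij hxy
    have h2 := @krewerasSetoid_of_union m π ρ hρ i j y x hij (sameBlock_symm hxy)
    have h3 := @krewerasSetoid_of_union m π ρ hρ j i x y (sameBlock_symm hij) hxy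
    have h4 := @krewerasSetoid_of_union m π ρ hρ j i y x (sameBlock_symm hij) (sameBlock_symm hxy)
    clear hij hxy hρ hi hj hb
    simp only [Fin.le_def, Fin.lt_def] at *
    by_cases c1 : i.1 ≤ x.1 <;> by_cases c2 : j.1 ≤ x.1 <;> by_cases c3 : i.1 ≤ y.1 <;>
      by_cases c4 : j.1 ≤ y.1 <;> simp only [c1, c2, c3, c4] <;> grind

end WishartMarginals

end

/-! Wick's formula turns the expected trace of a word of `p` letters into a sum over permutations
`α` of the letters, where `α` pairs each entry of the tensor with a conjugate entry. Let `γ` be the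
long cycle and write `#` for the number of cycles, fixed points included. The term of `α` is `N_A ^
#(γα⁻¹) * N ^ L(α) * N_D ^ #α`, where `L(α)` counts the cycles of a permutation of the `2p` index
slots attached to the factors `B` and `C` (`integral_trace`).

The quantity `card - #` is the length for the Cayley graph generated by transpositions. Its triangle
inequality gives `#(γα⁻¹) + #α ≤ p + 1`, with equality exactly when `α` lies on a geodesic from `1`
to `γ`, that is, when `α` is the permutation of a non-crossing partition (`geodesic_finRotate_iff`).
If every cycle of `α` uses a single letter, then `L(α) = #(γα⁻¹) + #α`; otherwise the genus
inequality `numCycles_add_add_le` forces `L(α) < p + 1`. As `N_D / N_A → 1`, each geodesic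
monochromatic `α` contributes `1` in the limit and every other `α` contributes `0`. Hence the limit
is the number of non-crossing partitions of the letters with monochromatic blocks.

To count these (`card_isMono`), separate the `AB` blocks `β` from the `AC` blocks `δ`, and let `π`
be the non-crossing partition of the `m` positions generated by `β`. The pair is non-crossing
exactly when `δ` refines the pullback of `π^Kr`, so there are `Cat_{π^Kr}(s)` choices of `δ`. The
number of `β` generating a partition below `σ` is `Cat_σ(r)`, and Möbius inversion yields the number
generating exactly `π`.

Refinement of non-crossing partitions agrees with the geodesic order (`geodesic_toPerm_iff`), so
left translation by `σ⁻¹` carries the interval `[σ, π]` to the geodesics below `σ⁻¹π`. There the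
signed Catalan products sum to zero unless `σ = π`, by the Catalan recursion; this identifies the
Möbius function. The unsigned analogue, `card_geodesic`, supplies the Catalan products above. -/

noncomputable section

set_option linter.unusedSectionVars false

/-! ### Counting classes of setoids -/

namespace WishartMarginals

open Equiv Equiv.Perm

/-- The number of classes of a setoid. -/
def numClasses {V : Type*} (r : Setoid V) : ℕ := Nat.card (Quotient r)

/-- The setoid obtained from `r` by merging the classes of `i` and `j`. -/
def linkSetoid {V : Type*} (r : Setoid V) (i j : V) : Setoid V where
  r x y := r x y ∨ ((r x i ∨ r x j) ∧ (r y i ∨ r y j))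
  iseqv :=
    { refl := fun x => Or.inl (r.refl x)
      symm := by
        rintro x y (h | ⟨h, h'⟩)
        · exact Or.inl (r.symm h)
        · exact Or.inr ⟨h', h⟩
      trans := by
        rintro x y z (h | ⟨h, h'⟩) (k | ⟨k, k'⟩)
        · exact Or.inl (r.trans h k)
        · exact Or.inr ⟨k.imp (r.trans h) (r.trans h), k'⟩
        · exact Or.inr ⟨h, h'.imp (r.trans (r.symm k)) (r.trans (r.symm k))⟩
        · exact Or.inr ⟨h, k'⟩ }

theorem le_linkSetoid {V : Type*} (r : Setoid V) (i j : V) : r ≤ linkSetoid r i j :=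
  fun _ _ h => Or.inl h

theorem linkSetoid_link {V : Type*} (r : Setoid V) (i j : V) : linkSetoid r i j i j :=
  Or.inr ⟨Or.inl (r.refl i), Or.inr (r.refl j)⟩

theorem linkSetoid_le {V : Type*} {r s : Setoid V} {i j : V} (h : r ≤ s) (hij : s i j) :
    linkSetoid r i j ≤ s := by
  have aux : ∀ x, r x i ∨ r x j → s x i := by
    rintro x (hx | hx)
    · exact h hx
    · exact s.trans (h hx) (s.symm hij)
  rintro x y (hxy | ⟨hx, hy⟩)
  · exact h hxy
  · exact s.trans (aux x hx) (s.symm (aux y hy))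

theorem linkSetoid_eq_self {V : Type*} {r : Setoid V} {i j : V} (hij : r i j) :
    linkSetoid r i j = r :=
  le_antisymm (linkSetoid_le le_rfl hij) (le_linkSetoid r i j)

theorem linkSetoid_sup {V : Type*} (r s : Setoid V) (i j : V) :
    r ⊔ linkSetoid s i j = linkSetoid (r ⊔ s) i j := by
  apply le_antisymm
  · refine sup_le (le_sup_left.trans (le_linkSetoid _ i j)) (linkSetoid_le ?_ (linkSetoid_link _ i j))
    exact le_sup_right.trans (le_linkSetoid _ i j)
  · refine linkSetoid_le (sup_le_sup_left (le_linkSetoid s i j) r) ?_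
    exact (le_sup_right : linkSetoid s i j ≤ _) (linkSetoid_link s i j)

/-- The classes of `r` other than that of `j` correspond bijectively to the merged classes. -/
theorem numClasses_linkSetoid {V : Type*} [Finite V] {r : Setoid V} {i j : V} (hij : ¬ r i j) :
    numClasses (linkSetoid r i j) + 1 = numClasses r := by
  classical
  have : Fintype (Quotient r) := Fintype.ofFinite _
  let φ : {q : Quotient r // q ≠ Quotient.mk r j} → Quotient (linkSetoid r i j) :=
    fun q => Quotient.map' (s₂ := linkSetoid r i j) id (le_linkSetoid r i j) q.1
  have hφ : Function.Bijective φ := by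
    constructor
    · rintro ⟨p, hp⟩ ⟨q, hq⟩ h
      induction p using Quotient.inductionOn with | _ x => ?_
      induction q using Quotient.inductionOn with | _ y => ?_
      have h' : linkSetoid r i j x y := Quotient.exact h
      have hx : ¬ r x j := fun h => hp (Quotient.sound h)
      have hy : ¬ r y j := fun h => hq (Quotient.sound h)
      refine Subtype.ext (Quotient.sound ?_)
      rcases h' with h' | ⟨h1, h2⟩
      · exact h'
      · exact r.trans (h1.resolve_right hx) (r.symm (h2.resolve_right hy))
    · intro q
      induction q using Quotient.inductionOn with | _ x => ?_
      by_cases hx : r x j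
      · refine ⟨⟨Quotient.mk r i, fun h => hij (Quotient.exact h)⟩, Quotient.sound ?_⟩
        exact Or.inr ⟨Or.inl (r.refl i), Or.inr hx⟩
      · exact ⟨⟨Quotient.mk r x, fun h => hx (Quotient.exact h)⟩, rfl⟩
  have h1 := Nat.card_congr (Equiv.ofBijective φ hφ)
  have h2 := Fintype.card_subtype_compl (fun q : Quotient r => q = Quotient.mk r j)
  have h3 : 0 < Fintype.card (Quotient r) := Fintype.card_pos_iff.2 ⟨Quotient.mk r j⟩
  rw [Fintype.card_subtype_eq] at h2
  unfold numClasses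
  rw [← h1, Nat.card_eq_fintype_card, Nat.card_eq_fintype_card]
  simp only [ne_eq]
  rw [h2]
  omega

theorem numClasses_le_card {V : Type*} [Fintype V] (r : Setoid V) :
    numClasses r ≤ Fintype.card V := by
  rw [← Nat.card_eq_fintype_card]
  exact Nat.card_le_card_of_surjective _ Quotient.mk_surjective

theorem numClasses_bot {V : Type*} [Fintype V] : numClasses (⊥ : Setoid V) = Fintype.card V := by
  rw [← Nat.card_eq_fintype_card]
  refine (Nat.card_congr (Equiv.ofBijective (Quotient.mk (⊥ : Setoid V))
    ⟨fun x y h => ?_, Quotient.mk_surjective⟩)).symm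
  exact Quotient.exact h

/-! ### The number of cycles of a permutation -/

variable {V : Type*}

theorem sameCycle_setoid_le {a : Perm V} {r : Setoid V} (h : ∀ x, r x (a x)) :
    SameCycle.setoid a ≤ r := by
  rintro x y ⟨n, rfl⟩
  induction n using Int.induction_on with
  | zero => exact r.refl _
  | succ n ih =>
    rw [add_comm, zpow_one_add, Perm.mul_apply]
    exact r.trans ih (h _)
  | pred n ih =>
    have h1 : a ((a ^ (-(n : ℤ) - 1)) x) = (a ^ (-(n : ℤ))) x := by
      rw [← Perm.mul_apply, ← zpow_one_add, add_sub_cancel]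
    have h2 := h ((a ^ (-(n : ℤ) - 1)) x)
    rw [h1] at h2
    exact r.trans ih (r.symm h2)

/-- The number of cycles of a permutation, fixed points included. -/
def numCycles (a : Perm V) : ℕ := numClasses (SameCycle.setoid a)

theorem numCycles_inv (a : Perm V) : numCycles a⁻¹ = numCycles a := by
  unfold numCycles
  congr 1
  ext x y
  exact sameCycle_inv

theorem numCycles_conj (a b : Perm V) : numCycles (b * a * b⁻¹) = numCycles a := by
  unfold numCycles numClasses
  refine Nat.card_congr (Quotient.congr b⁻¹ fun x y => ?_)
  exact sameCycle_conj

theorem numCycles_mul_comm (a b : Perm V) : numCycles (a * b) = numCycles (b * a) := by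
  rw [← numCycles_conj (a * b) b]
  congr 1
  group

theorem numCycles_le_card [Fintype V] (a : Perm V) : numCycles a ≤ Fintype.card V :=
  numClasses_le_card _

theorem setoid_one : SameCycle.setoid (1 : Perm V) = ⊥ := by
  ext x y
  exact sameCycle_one

theorem numCycles_one [Fintype V] : numCycles (1 : Perm V) = Fintype.card V := by
  rw [numCycles, setoid_one, numClasses_bot]

variable [DecidableEq V]

/-- After composition with the transposition, a walk started at `i` enters the `a`-orbit of `j` and
follows it until that orbit next meets `i` or `j`. -/
theorem mul_swap_pow_apply {a : Perm V} {i j : V} {b : ℕ}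
    (h : ∀ c, 0 < c → c < b → (a ^ c) j ≠ i ∧ (a ^ c) j ≠ j) :
    ∀ c, 0 < c → c ≤ b → ((a * swap i j) ^ c) i = (a ^ c) j := by
  intro c hc hcb
  induction c with
  | zero => omega
  | succ c ih =>
    rcases Nat.eq_zero_or_pos c with rfl | hc'
    · simp
    · rw [pow_succ', Perm.mul_apply, ih hc' (by omega), pow_succ' a, Perm.mul_apply, Perm.mul_apply,
        swap_apply_of_ne_of_ne (h c hc' (by omega)).1 (h c hc' (by omega)).2]

theorem setoid_le_link_mul_swap (a : Perm V) (i j : V) :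
    SameCycle.setoid a ≤ linkSetoid (SameCycle.setoid (a * swap i j)) i j := by
  set r := SameCycle.setoid (a * swap i j)
  have step : ∀ x, r x (a (swap i j x)) := fun x => ⟨1, by simp⟩
  refine sameCycle_setoid_le fun x => ?_
  by_cases hi : x = i
  · subst hi
    have := step j
    rw [swap_apply_right] at this
    exact Or.inr ⟨Or.inl (r.refl _), Or.inr (r.symm this)⟩
  by_cases hj : x = j
  · subst hj
    have := step i
    rw [swap_apply_left] at this
    exact Or.inr ⟨Or.inr (r.refl _), Or.inl (r.symm this)⟩
  · have := step x
    rw [swap_apply_of_ne_of_ne hi hj] at this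
    exact Or.inl this

/-- The transposition only exchanges the images of `i` and `j`, so `a` and `a * swap i j` become
indistinguishable once `i` and `j` are glued. The cycle counts of both are then read off the common
setoid: one of the two already has `i` and `j` in the same cycle, the other loses one class. -/
theorem link_mul_swap (a : Perm V) (i j : V) :
    linkSetoid (SameCycle.setoid (a * swap i j)) i j = linkSetoid (SameCycle.setoid a) i j := by
  apply le_antisymm
  · refine linkSetoid_le ?_ (linkSetoid_link _ i j)
    have := setoid_le_link_mul_swap (a * swap i j) i j
    rwa [mul_swap_mul_self] at this
  · exact linkSetoid_le (setoid_le_link_mul_swap a i j) (linkSetoid_link _ i j)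

variable [Fintype V]

theorem exists_min_pow {a : Perm V} {i j : V} (h : SameCycle a i j) :
    ∃ b : ℕ, 0 < b ∧ (a ^ b) i = j ∧ ∀ c, 0 < c → c < b → (a ^ c) i ≠ j := by
  classical
  have hex : ∃ b : ℕ, 0 < b ∧ (a ^ b) i = j := by
    obtain ⟨b, hb, -, hbj⟩ := h.exists_pow_eq'' 
    exact ⟨b, hb, hbj⟩
  refine ⟨Nat.find hex, (Nat.find_spec hex).1, (Nat.find_spec hex).2, fun c hc hcb h' => ?_⟩
  exact Nat.find_min hex hcb ⟨hc, h'⟩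

theorem sameCycle_mul_swap {a : Perm V} {i j : V} (h : ¬ SameCycle a i j) :
    SameCycle (a * swap i j) i j := by
  obtain ⟨b, hb, hbj, hmin⟩ := exists_min_pow (SameCycle.refl a j)
  refine ⟨b, ?_⟩
  rw [zpow_natCast, mul_swap_pow_apply (b := b) ?_ b hb le_rfl, hbj]
  exact fun c hc hcb => ⟨fun h' => h (SameCycle.symm ⟨c, by simpa using h'⟩), hmin c hc hcb⟩

theorem not_sameCycle_mul_swap {a : Perm V} {i j : V} (hij : i ≠ j) (h : SameCycle a i j) :
    ¬ SameCycle (a * swap i j) i j := by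
  obtain ⟨b, hb, hbi, hmin⟩ := exists_min_pow h.symm
  -- the orbit of `i` under the new permutation closes up after `b` steps without meeting `j`
  have hne : ∀ c, 0 < c → c ≤ b → (a ^ c) j ≠ j := by
    intro c hc hcb hcj
    rcases hcb.lt_or_eq with hlt | rfl
    · apply hmin (b - c) (by omega) (by omega)
      have : (a ^ (b - c)) ((a ^ c) j) = i := by
        rw [← Perm.mul_apply, ← pow_add, Nat.sub_add_cancel hcb, hbi]
      rwa [hcj] at this
    · exact hij (hbi ▸ hcj)
  have hp := mul_swap_pow_apply (a := a) (i := i) (j := j) (b := b)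
    (fun c hc hcb => ⟨hmin c hc hcb, hne c hc hcb.le⟩)
  intro hs
  obtain ⟨c, hc, hcj, hcmin⟩ := exists_min_pow hs
  have hb' : ((a * swap i j) ^ b) i = i := by rw [hp b hb le_rfl, hbi]
  have hcb : c ≤ b := by
    by_contra hlt
    apply hcmin (c - b) (by omega) (by omega)
    have : ((a * swap i j) ^ (c - b)) (((a * swap i j) ^ b) i) = j := by
      rw [← Perm.mul_apply, ← pow_add, Nat.sub_add_cancel (by omega), hcj]
    rwa [hb'] at this
  rw [hp c hc hcb] at hcj
  exact hne c hc hcb hcj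

theorem numCycles_mul_swap_of_sameCycle {a : Perm V} {i j : V} (hij : i ≠ j)
    (h : SameCycle a i j) : numCycles (a * swap i j) = numCycles a + 1 := by
  have h1 := numClasses_linkSetoid (r := SameCycle.setoid (a * swap i j))
    (not_sameCycle_mul_swap hij h)
  rw [link_mul_swap, linkSetoid_eq_self (r := SameCycle.setoid a) h] at h1
  exact h1.symm

theorem numCycles_mul_swap_of_not_sameCycle {a : Perm V} {i j : V}
    (h : ¬ SameCycle a i j) : numCycles (a * swap i j) + 1 = numCycles a := by
  have h1 := numClasses_linkSetoid (r := SameCycle.setoid a) h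
  rw [← link_mul_swap, linkSetoid_eq_self (r := SameCycle.setoid (a * swap i j))
    (sameCycle_mul_swap h)] at h1
  exact h1

theorem setoid_mul_swap_of_not_sameCycle {a : Perm V} {i j : V} (h : ¬ SameCycle a i j) :
    SameCycle.setoid (a * swap i j) = linkSetoid (SameCycle.setoid a) i j := by
  rw [← link_mul_swap, linkSetoid_eq_self (r := SameCycle.setoid (a * swap i j))
    (sameCycle_mul_swap h)]

theorem sameCycle_of_mul_swap {a : Perm V} {i j x y : V} (h : SameCycle a i j)
    (hxy : SameCycle (a * swap i j) x y) : SameCycle a x y := by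
  have := le_linkSetoid _ i j (show SameCycle.setoid (a * swap i j) x y from hxy)
  rw [link_mul_swap, linkSetoid_eq_self (r := SameCycle.setoid a) h] at this
  exact this

theorem sameCycle_mul_swap_or {a : Perm V} {i j x : V} (h : SameCycle a x i) :
    SameCycle (a * swap i j) x i ∨ SameCycle (a * swap i j) x j := by
  have := setoid_le_link_mul_swap a i j (show SameCycle.setoid a x i from h)
  rcases this with h | ⟨h, -⟩
  · exact Or.inl h
  · exact h

/-- Build a permutation from the identity by transpositions that join two cycles. -/
theorem swap_join_induction {p : Perm V → Prop} (one : p 1)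
    (join : ∀ b i j, ¬ SameCycle b i j → p b → p (b * swap i j)) (b : Perm V) : p b := by
  -- This difference is the transposition length of `b`; cutting the pair `x`, `b x` lowers it by
  -- one.
  induction hn : Fintype.card V - numCycles b generalizing b with
  | zero =>
    by_cases hb : b = 1
    · exact hb ▸ one
    obtain ⟨x, hx⟩ : ∃ x, b x ≠ x := by
      by_contra! h
      exact hb (Equiv.ext h)
    have := numCycles_mul_swap_of_sameCycle (Ne.symm hx) (⟨1, by simp⟩ : SameCycle b x (b x))
    have := numCycles_le_card (b * swap x (b x))
    omega
  | succ n ih =>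
    have hb : b ≠ 1 := by
      rintro rfl
      rw [numCycles_one] at hn
      omega
    obtain ⟨x, hx⟩ : ∃ x, b x ≠ x := by
      by_contra! h
      exact hb (Equiv.ext h)
    have hs : SameCycle b x (b x) := ⟨1, by simp⟩
    have h1 := numCycles_mul_swap_of_sameCycle (Ne.symm hx) hs
    have := join (b * swap x (b x)) x (b x) (not_sameCycle_mul_swap (Ne.symm hx) hs)
      (ih _ (by omega))
    rwa [mul_swap_mul_self] at this

theorem numCycles_mul_swap_le (a : Perm V) (i j : V) :
    numCycles (a * swap i j) ≤ numCycles a + 1 := by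
  rcases eq_or_ne i j with rfl | hij
  · simp [swap_self, ← Perm.one_def]
  by_cases h : SameCycle a i j
  · exact (numCycles_mul_swap_of_sameCycle hij h).le
  · have := numCycles_mul_swap_of_not_sameCycle h
    omega

theorem le_numCycles_mul_swap (a : Perm V) (i j : V) :
    numCycles a ≤ numCycles (a * swap i j) + 1 := by
  have := numCycles_mul_swap_le (a * swap i j) i j
  rwa [mul_swap_mul_self] at this

theorem eq_one_of_numCycles {a : Perm V} (h : numCycles a = Fintype.card V) : a = 1 := by
  by_contra ha
  obtain ⟨x, hx⟩ : ∃ x, a x ≠ x := by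
    by_contra! h
    exact ha (Equiv.ext h)
  have := numCycles_mul_swap_of_sameCycle (Ne.symm hx) (⟨1, by simp⟩ : SameCycle a x (a x))
  have := numCycles_le_card (a * swap x (a x))
  omega

/-- This is the triangle inequality for the length `card - numCycles`. -/
theorem numCycles_add_le (a b : Perm V) :
    numCycles a + numCycles b ≤ Fintype.card V + numCycles (a * b) := by
  induction b using swap_join_induction with
  | one => rw [numCycles_one, mul_one, add_comm]
  | join b i j h ih =>
    have h1 := numCycles_mul_swap_of_not_sameCycle h
    have h2 := le_numCycles_mul_swap (a * b) i j
    rw [← mul_assoc]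
    omega

/-- The genus inequality: for two permutations, cycles of the two and of their product. -/
theorem numCycles_add_add_le (a b : Perm V) :
    numCycles a + numCycles b + numCycles (a * b) ≤
      Fintype.card V + 2 * numClasses (SameCycle.setoid a ⊔ SameCycle.setoid b) := by
  induction b using swap_join_induction with
  | one =>
    rw [numCycles_one, mul_one, setoid_one, sup_bot_eq, ← numCycles]
    omega
  | join b i j h ih =>
    have h1 := numCycles_mul_swap_of_not_sameCycle h
    rw [setoid_mul_swap_of_not_sameCycle h, linkSetoid_sup, ← mul_assoc]
    by_cases hs : (SameCycle.setoid a ⊔ SameCycle.setoid b) i j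
    · rw [linkSetoid_eq_self hs]
      have := numCycles_mul_swap_le (a * b) i j
      omega
    -- Two joint classes merge, which costs `2` on the right. The cycles of `a * b` refine the joint
    -- classes, so `b` and `a * b` both lose a cycle and the left side also drops by `2`.
    · have h2 := numClasses_linkSetoid hs
      have hab : ¬ SameCycle (a * b) i j := by
        intro hab
        refine hs ((sameCycle_setoid_le (r := SameCycle.setoid a ⊔ SameCycle.setoid b)
          fun x => ?_) hab)
        have h1 : (SameCycle.setoid a ⊔ SameCycle.setoid b) x (b x) :=
          (le_sup_right : SameCycle.setoid b ≤ SameCycle.setoid a ⊔ _) ⟨1, by simp⟩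
        have h2 : (SameCycle.setoid a ⊔ SameCycle.setoid b) (b x) ((a * b) x) :=
          (le_sup_left : _ ≤ SameCycle.setoid a ⊔ SameCycle.setoid b) ⟨1, by simp⟩
        exact (SameCycle.setoid a ⊔ SameCycle.setoid b).trans h1 h2
      have h3 := numCycles_mul_swap_of_not_sameCycle hab
      omega

/-! ### The geodesic order -/

/-- `ρ` lies on a geodesic from `1` to `κ` in the Cayley graph generated by transpositions. -/
def Geodesic (ρ κ : Perm V) : Prop :=
  numCycles ρ + numCycles (ρ⁻¹ * κ) = Fintype.card V + numCycles κ

theorem geodesic_of_le {ρ κ : Perm V}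
    (h : Fintype.card V + numCycles κ ≤ numCycles ρ + numCycles (ρ⁻¹ * κ)) : Geodesic ρ κ := by
  have := numCycles_add_le ρ (ρ⁻¹ * κ)
  rw [mul_inv_cancel_left] at this
  exact le_antisymm this h

theorem Geodesic.refl (κ : Perm V) : Geodesic κ κ := by
  rw [Geodesic, inv_mul_cancel, numCycles_one, add_comm]

theorem geodesic_one_right_iff {ρ : Perm V} : Geodesic ρ 1 ↔ ρ = 1 := by
  constructor
  · intro h
    rw [Geodesic, mul_one, numCycles_inv, numCycles_one] at h
    exact eq_one_of_numCycles (by omega)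
  · rintro rfl
    exact Geodesic.refl 1

/-- If the transposition joined two cycles of `κ` while splitting one of `ρ⁻¹ * κ`, the triangle
inequality would fail. So it splits a cycle of `κ` as well, and the two sides of the geodesic
identity grow together. -/
theorem Geodesic.mul_swap {ρ κ : Perm V} {i j : V} (h : Geodesic ρ κ) (hij : i ≠ j)
    (hs : SameCycle (ρ⁻¹ * κ) i j) : SameCycle κ i j ∧ Geodesic ρ (κ * swap i j) := by
  have h1 := numCycles_mul_swap_of_sameCycle hij hs
  have h2 := numCycles_add_le ρ (ρ⁻¹ * κ * swap i j)
  rw [← mul_assoc, mul_inv_cancel_left] at h2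
  rw [Geodesic] at h
  have h3 : SameCycle κ i j := by
    by_contra h3
    have := numCycles_mul_swap_of_not_sameCycle h3
    omega
  refine ⟨h3, ?_⟩
  have := numCycles_mul_swap_of_sameCycle hij h3
  rw [Geodesic, ← mul_assoc]
  omega

theorem geodesic_mul_swap_iff {ρ κ : Perm V} {i j : V} (hij : i ≠ j) (hs : SameCycle κ i j) :
    Geodesic ρ (κ * swap i j) ↔ Geodesic ρ κ ∧ SameCycle (ρ⁻¹ * κ) i j := by
  refine ⟨fun h => ?_, fun h => (h.1.mul_swap hij h.2).2⟩
  have h1 := numCycles_mul_swap_of_sameCycle hij hs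
  rw [Geodesic, ← mul_assoc] at h
  have h2 := numCycles_mul_swap_le (ρ⁻¹ * κ) i j
  have hg : Geodesic ρ κ := geodesic_of_le (by omega)
  refine ⟨hg, ?_⟩
  by_contra h3
  have := numCycles_mul_swap_of_not_sameCycle h3
  rw [Geodesic] at hg
  omega

/-- Stripping the transpositions of `ρ⁻¹ * κ` one by one leads from `κ` down to `ρ`, and on a
geodesic each of them only cuts a cycle. -/
theorem Geodesic.setoid_le {ρ κ : Perm V} (h : Geodesic ρ κ) :
    SameCycle.setoid ρ ≤ SameCycle.setoid κ := by
  obtain ⟨μ, rfl⟩ : ∃ μ, κ = ρ * μ := ⟨ρ⁻¹ * κ, by group⟩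
  induction μ using swap_join_induction with
  | one => rw [mul_one]
  | join b i j hb ih =>
    have hij : i ≠ j := by
      rintro rfl
      exact hb (SameCycle.refl _ _)
    have h1 := h.mul_swap hij (by rw [inv_mul_cancel_left]; exact sameCycle_mul_swap hb)
    rw [← mul_assoc] at h1 ⊢
    have h2 := h1.2
    rw [mul_swap_mul_self] at h2
    intro x y hxy
    refine sameCycle_of_mul_swap h1.1 ?_
    rw [mul_swap_mul_self]
    exact ih h2 hxy

theorem Geodesic.sameCycle {ρ κ : Perm V} (h : Geodesic ρ κ) {x y : V} (hxy : SameCycle ρ x y) :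
    SameCycle κ x y := h.setoid_le hxy

/-- Descend from `κ` to any permutation geodesically below it, cutting one cycle at a time. -/
theorem Geodesic.induction {p : Perm V → Prop} {κ ρ : Perm V} (h : Geodesic ρ κ) (top : p κ)
    (cut : ∀ a i j, i ≠ j → SameCycle a i j → p a → p (a * swap i j)) : p ρ := by
  obtain ⟨μ, rfl⟩ : ∃ μ, κ = ρ * μ := ⟨ρ⁻¹ * κ, by group⟩
  induction μ using swap_join_induction with
  | one => rwa [mul_one] at top
  | join b i j hb ih =>
    have hij : i ≠ j := by
      rintro rfl
      exact hb (SameCycle.refl _ _)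
    have h1 := h.mul_swap hij (by rw [inv_mul_cancel_left]; exact sameCycle_mul_swap hb)
    rw [← mul_assoc] at h1 top
    have h2 := cut _ i j hij h1.1 top
    rw [mul_swap_mul_self] at h1 h2
    exact ih h1.2 h2

/-- Geodesics from `1` to `ρ⁻¹ κ` are the translates of geodesics from `ρ` to `κ`. -/
theorem Geodesic.trans {σ τ π : Perm V} (h : Geodesic σ π) (h' : Geodesic (σ⁻¹ * τ) (σ⁻¹ * π)) :
    Geodesic τ π ∧ Geodesic σ τ := by
  rw [Geodesic] at h h'
  have e : (σ⁻¹ * τ)⁻¹ * (σ⁻¹ * π) = τ⁻¹ * π := by group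
  rw [e] at h'
  have h1 := numCycles_add_le σ (σ⁻¹ * τ)
  have h2 := numCycles_add_le τ (τ⁻¹ * π)
  rw [mul_inv_cancel_left] at h1 h2
  constructor <;> rw [Geodesic] <;> omega

theorem Geodesic.translate {σ τ π : Perm V} (h : Geodesic σ τ) (h' : Geodesic τ π)
    (h'' : Geodesic σ π) : Geodesic (σ⁻¹ * τ) (σ⁻¹ * π) := by
  rw [Geodesic] at *
  have e : (σ⁻¹ * τ)⁻¹ * (σ⁻¹ * π) = τ⁻¹ * π := by group
  rw [e]
  omega

end WishartMarginals

/-! ### Products over the cycles of a permutation -/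

namespace WishartMarginals

open Equiv Equiv.Perm

variable {V : Type*} [DecidableEq V] [Fintype V]

/-- The cycle of `x`, as a finset. -/
def orbit (a : Perm V) (x : V) : Finset V := Finset.univ.filter (SameCycle a x)

/-- The cycles of `a`, fixed points included, as finsets. -/
def cycles (a : Perm V) : Finset (Finset V) := Finset.univ.image (orbit a)

/-- The product of `w (length c)` over the cycles `c` of `a`, fixed points included. -/
def cycleProd {M : Type*} [CommMonoid M] (w : ℕ → M) (a : Perm V) : M :=
  ∏ b ∈ cycles a, w b.card

/-- The product of `w (length c)` over the cycles `c` of `a` that do not contain `i`. -/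
def restProd {M : Type*} [CommMonoid M] (w : ℕ → M) (a : Perm V) (i : V) : M :=
  ∏ b ∈ (cycles a).erase (orbit a i), w b.card

theorem mem_orbit {a : Perm V} {x y : V} : y ∈ orbit a x ↔ SameCycle a x y := by
  simp [orbit]

theorem orbit_eq_orbit {a : Perm V} {x y : V} : orbit a x = orbit a y ↔ SameCycle a x y := by
  constructor
  · intro h
    rw [← mem_orbit, h, mem_orbit]
  · intro h
    ext z
    rw [mem_orbit, mem_orbit]
    exact ⟨h.symm.trans, h.trans⟩

theorem orbit_mem_cycles (a : Perm V) (x : V) : orbit a x ∈ cycles a :=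
  Finset.mem_image_of_mem _ (Finset.mem_univ x)

theorem mem_cycles {a : Perm V} {b : Finset V} : b ∈ cycles a ↔ ∃ x, orbit a x = b := by
  simp [cycles]

theorem cycleProd_eq_mul_restProd {M : Type*} [CommMonoid M] (w : ℕ → M) (a : Perm V) (i : V) :
    cycleProd w a = w (orbit a i).card * restProd w a i :=
  (Finset.mul_prod_erase _ (fun b : Finset V => w b.card) (orbit_mem_cycles a i)).symm

theorem restProd_congr {M : Type*} [CommMonoid M] (w : ℕ → M) {a : Perm V} {i j : V}
    (h : SameCycle a i j) : restProd w a i = restProd w a j := by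
  rw [restProd, restProd, orbit_eq_orbit.2 h]

theorem sameCycle_mul_swap_iff {a : Perm V} {i j x y : V} (h : SameCycle a i j)
    (hx : ¬ SameCycle a x i) : SameCycle (a * swap i j) x y ↔ SameCycle a x y := by
  refine ⟨sameCycle_of_mul_swap h, fun hxy => ?_⟩
  rcases setoid_le_link_mul_swap a i j (show SameCycle.setoid a x y from hxy) with h' | ⟨h1, -⟩
  · exact h'
  · rcases h1 with h1 | h1
    · exact absurd (sameCycle_of_mul_swap h h1) hx
    · exact absurd ((sameCycle_of_mul_swap h h1).trans h.symm) hx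

theorem orbit_mul_swap {a : Perm V} {i j x : V} (h : SameCycle a i j)
    (hx : ¬ SameCycle a x i) : orbit (a * swap i j) x = orbit a x := by
  ext y
  rw [mem_orbit, mem_orbit, sameCycle_mul_swap_iff h hx]

/-- The cut affects a single cycle: apart from the piece containing `i`, the new cycles are the
piece containing `j` and the untouched ones. -/
theorem cycles_mul_swap_erase {a : Perm V} {i j : V} (hij : i ≠ j) (h : SameCycle a i j) :
    (cycles (a * swap i j)).erase (orbit (a * swap i j) i) =
      insert (orbit (a * swap i j) j) ((cycles a).erase (orbit a i)) := by
  have hn := not_sameCycle_mul_swap hij h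
  ext b
  simp only [Finset.mem_erase, Finset.mem_insert, mem_cycles]
  constructor
  · rintro ⟨hb, x, rfl⟩
    by_cases hx : SameCycle a x i
    · left
      rw [orbit_eq_orbit]
      rcases sameCycle_mul_swap_or (j := j) hx with h1 | h1
      · exact absurd (orbit_eq_orbit.2 h1) hb
      · exact h1
    · right
      rw [orbit_mul_swap h hx]
      exact ⟨fun h' => hx (orbit_eq_orbit.1 h'), x, rfl⟩
  · rintro (rfl | ⟨hb, x, rfl⟩)
    · exact ⟨fun h' => hn (orbit_eq_orbit.1 h').symm, j, rfl⟩
    · have hx : ¬ SameCycle a x i := fun h' => hb (orbit_eq_orbit.2 h')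
      refine ⟨fun h' => hx ?_, x, orbit_mul_swap h hx⟩
      rw [← orbit_mul_swap h hx, orbit_eq_orbit] at h'
      exact sameCycle_of_mul_swap h h'

theorem restProd_mul_swap {M : Type*} [CommMonoid M] (w : ℕ → M) {a : Perm V} {i j : V}
    (hij : i ≠ j) (h : SameCycle a i j) :
    restProd w (a * swap i j) i = w (orbit (a * swap i j) j).card * restProd w a i := by
  rw [restProd, cycles_mul_swap_erase hij h, Finset.prod_insert, restProd]
  rw [Finset.mem_erase, mem_cycles]
  rintro ⟨hb, x, hx⟩
  have h1 : SameCycle a x j := by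
    rw [← mem_orbit, hx, mem_orbit]
  apply hb
  rw [← hx, orbit_eq_orbit]
  exact h1.trans h.symm

theorem orbit_eq_image (a : Perm V) (i : V) :
    orbit a i = (Finset.range (Function.minimalPeriod a i)).image fun c => (a ^ c) i := by
  ext y
  rw [mem_orbit, Finset.mem_image]
  constructor
  · intro h
    obtain ⟨b, -, hb⟩ := h.exists_pow_eq'
    refine ⟨b % Function.minimalPeriod a i, ?_, ?_⟩
    · rw [Finset.mem_range]
      exact Nat.mod_lt _ (Function.minimalPeriod_pos_of_mem_periodicPts
        (Function.mem_periodicPts.2 ⟨orderOf a, orderOf_pos a, by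
          rw [Function.IsPeriodicPt, Function.IsFixedPt, Perm.iterate_eq_pow, pow_orderOf_eq_one,
            Perm.one_apply]⟩))
    · rw [← hb, ← Perm.iterate_eq_pow, ← Perm.iterate_eq_pow, Function.iterate_mod_minimalPeriod_eq]
  · rintro ⟨b, -, hb⟩
    exact ⟨b, by simpa using hb⟩

theorem pow_apply_injOn (a : Perm V) (i : V) :
    Set.InjOn (fun c => (a ^ c) i) (Finset.range (Function.minimalPeriod a i)) := by
  have := Function.iterate_injOn_Iio_minimalPeriod (f := a) (x := i)
  simpa [Perm.iterate_eq_pow, Set.InjOn] using this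

theorem card_orbit (a : Perm V) (i : V) : (orbit a i).card = Function.minimalPeriod a i := by
  rw [orbit_eq_image, Finset.card_image_of_injOn (pow_apply_injOn a i), Finset.card_range]

theorem pow_card_orbit (a : Perm V) (i : V) : (a ^ (orbit a i).card) i = i := by
  rw [card_orbit, ← Perm.iterate_eq_pow]
  exact Function.isPeriodicPt_minimalPeriod a i

theorem card_orbit_pos (a : Perm V) (i : V) : 0 < (orbit a i).card :=
  Finset.card_pos.2 ⟨i, mem_orbit.2 (SameCycle.refl _ _)⟩

theorem pow_apply_ne {a : Perm V} {i : V} {b c : ℕ} (hb : b < (orbit a i).card)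
    (hc : c < (orbit a i).card) (h : b ≠ c) : (a ^ b) i ≠ (a ^ c) i := by
  rw [card_orbit] at hb hc
  exact fun h' => h (pow_apply_injOn a i (by simpa using hb) (by simpa using hc) h')

theorem sum_orbit_erase {M : Type*} [AddCommMonoid M] (a : Perm V) (i : V) (g : V → M) :
    ∑ j ∈ (orbit a i).erase i, g j =
      ∑ c ∈ Finset.Ico 1 (orbit a i).card, g ((a ^ c) i) := by
  have hk := card_orbit_pos a i
  symm
  refine Finset.sum_nbij (fun c => (a ^ c) i) ?_ ?_ ?_ (fun _ _ => rfl)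
  · intro c hc
    rw [Finset.mem_Ico] at hc
    rw [Finset.mem_erase, mem_orbit]
    exact ⟨pow_apply_ne (c := 0) hc.2 hk (by omega), c, by simp⟩
  · intro b hb c hc h
    simp only [Finset.coe_Ico, Set.mem_Ico] at hb hc
    by_contra hbc
    exact pow_apply_ne hb.2 hc.2 hbc h
  · intro y hy
    rw [Finset.mem_coe, Finset.mem_erase, orbit_eq_image, Finset.mem_image] at hy
    obtain ⟨h1, c, hc, rfl⟩ := hy
    rw [Finset.mem_range, ← card_orbit] at hc
    refine ⟨c, ?_, rfl⟩
    simp only [Finset.coe_Ico, Set.mem_Ico]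
    refine ⟨Nat.one_le_iff_ne_zero.2 ?_, hc⟩
    rintro rfl
    simp at h1

/-- With `j = a ^ b i`, the new permutation sends `j` to `a i`, so the cycle of `j` is `a i, …, a ^
b i`; the cycle of `i` keeps the remaining points. -/
theorem card_orbit_mul_swap {a : Perm V} {i : V} {b : ℕ} (hb : 0 < b)
    (hbk : b < (orbit a i).card) :
    (orbit (a * swap i ((a ^ b) i)) ((a ^ b) i)).card = b ∧
      (orbit (a * swap i ((a ^ b) i)) i).card = (orbit a i).card - b := by
  set j := (a ^ b) i with hj
  have hk := card_orbit_pos a i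
  have hij : i ≠ j := (pow_apply_ne (c := 0) hbk hk (by omega)).symm
  have hs : SameCycle a i j := ⟨b, by simp [hj]⟩
  have hp := mul_swap_pow_apply (a := a) (i := j) (j := i) (b := b) (fun c hc hcb =>
    ⟨pow_apply_ne (by omega) hbk (by omega), pow_apply_ne (c := 0) (by omega) hk (by omega)⟩)
  rw [swap_comm] at hp
  set a' := a * swap i j
  have h1 : Function.minimalPeriod a' j = b := by
    have hper : Function.IsPeriodicPt a' b j := by
      rw [Function.IsPeriodicPt, Function.IsFixedPt, Perm.iterate_eq_pow, hp b hb le_rfl]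
    apply le_antisymm (hper.minimalPeriod_le hb)
    by_contra hlt
    have hpos := hper.minimalPeriod_pos hb
    have h2 := Function.isPeriodicPt_minimalPeriod a' j
    rw [Function.IsPeriodicPt, Function.IsFixedPt, Perm.iterate_eq_pow, hp _ hpos (by omega)] at h2
    exact pow_apply_ne (a := a) (i := i) (by omega) hbk (by omega) h2
  have h2 : (orbit a' j).card = b := by rw [card_orbit, h1]
  refine ⟨h2, ?_⟩
  have hn : ¬ SameCycle a' i j := not_sameCycle_mul_swap hij hs
  have hu : orbit a i = orbit a' i ∪ orbit a' j := by
    ext y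
    rw [Finset.mem_union, mem_orbit, mem_orbit, mem_orbit]
    constructor
    · intro h
      exact (sameCycle_mul_swap_or (j := j) h.symm).imp SameCycle.symm SameCycle.symm
    · rintro (h | h)
      · exact sameCycle_of_mul_swap hs h
      · exact hs.trans (sameCycle_of_mul_swap hs h)
  have hd : Disjoint (orbit a' i) (orbit a' j) := by
    rw [Finset.disjoint_left]
    intro y hy hy'
    rw [mem_orbit] at hy hy'
    exact hn (hy.trans hy'.symm)
  rw [hu, Finset.card_union_of_disjoint hd, h2]
  omega

theorem pow_pred_card_orbit (a : Perm V) (i : V) : (a ^ ((orbit a i).card - 1)) i = a⁻¹ i := by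
  rw [Perm.eq_inv_iff_eq, ← Perm.mul_apply, ← pow_succ', Nat.sub_add_cancel (card_orbit_pos a i),
    pow_card_orbit]

theorem card_orbit_eq_one {a : Perm V} {i : V} : (orbit a i).card = 1 ↔ a i = i := by
  rw [card_orbit, Function.minimalPeriod_eq_one_iff_isFixedPt]
  rfl

/-- The effect on `cycleProd` of removing `i` from its cycle. -/
theorem cycleProd_remove {M : Type*} [CommMonoid M] (w : ℕ → M) (h0 : w 0 = 1) (h1 : w 1 = 1)
    (a : Perm V) (i : V) :
    cycleProd w (a * swap i (a⁻¹ i)) = w ((orbit a i).card - 1) * restProd w a i := by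
  by_cases h : a i = i
  -- If `i` is already fixed, nothing is removed and the truncated length is `0`; this is where `w 0
  -- = 1` is needed. In the other case `w 1 = 1` absorbs the new fixed point.
  · have h' : a⁻¹ i = i := by rw [Perm.inv_eq_iff_eq, h]
    rw [h', swap_self, ← Perm.one_def, mul_one, cycleProd_eq_mul_restProd w a i,
      card_orbit_eq_one.2 h, h0, h1]
  · have hk : 1 < (orbit a i).card := by
      have := card_orbit_pos a i
      have := mt card_orbit_eq_one.1 h
      omega
    have h2 := card_orbit_mul_swap (a := a) (i := i) (b := (orbit a i).card - 1)
      (by omega) (by omega)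
    have hs : SameCycle a i ((a ^ ((orbit a i).card - 1)) i) := ⟨((orbit a i).card - 1 : ℕ), by rw [zpow_natCast]⟩
    have hij : i ≠ (a ^ ((orbit a i).card - 1)) i :=
      (pow_apply_ne (a := a) (i := i) (c := 0) (by omega) (by omega) (by omega)).symm
    rw [← pow_pred_card_orbit, cycleProd_eq_mul_restProd w _ i, h2.2, restProd_mul_swap w hij hs,
      h2.1, show (orbit a i).card - ((orbit a i).card - 1) = 1 by omega, h1, one_mul]

theorem cycleProd_mul_swap {M : Type*} [CommMonoid M] (w : ℕ → M) {a : Perm V} {i : V} {b : ℕ}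
    (hb : 0 < b) (hbk : b < (orbit a i).card) :
    cycleProd w (a * swap i ((a ^ b) i)) =
      w ((orbit a i).card - b) * (w b * restProd w a i) := by
  have h2 := card_orbit_mul_swap hb hbk
  have hs : SameCycle a i ((a ^ b) i) := ⟨b, by simp⟩
  have hij : i ≠ (a ^ b) i := (pow_apply_ne (a := a) (i := i) (c := 0) hbk (by omega) (by omega)).symm
  rw [cycleProd_eq_mul_restProd w _ i, h2.2, restProd_mul_swap w hij hs, h2.1]

theorem cycles_one : cycles (1 : Perm V) = Finset.univ.image fun x => {x} := by
  have : ∀ x, orbit (1 : Perm V) x = {x} := fun x => by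
    ext y
    simp [mem_orbit, eq_comm]
  simp only [cycles, funext this]

theorem cycleProd_one {M : Type*} [CommMonoid M] (w : ℕ → M) (h1 : w 1 = 1) :
    cycleProd w (1 : Perm V) = 1 := by
  rw [cycleProd, cycles_one]
  refine Finset.prod_eq_one fun b hb => ?_
  obtain ⟨x, -, rfl⟩ := Finset.mem_image.1 hb
  simpa using h1

/-! ### Sums over geodesic intervals -/

/-- The permutation `κ * swap i (κ⁻¹ i)` is `κ` with `i` taken out of its cycle, so anything below
it fixes `i`. -/
theorem geodesic_remove_iff {ρ κ : Perm V} {i : V} :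
    Geodesic ρ (κ * swap i (κ⁻¹ i)) ↔ Geodesic ρ κ ∧ ρ i = i := by
  by_cases h : κ i = i
  · have h' : κ⁻¹ i = i := by rw [Perm.inv_eq_iff_eq, h]
    rw [h', swap_self, ← Perm.one_def, mul_one]
    refine ⟨fun hg => ⟨hg, ?_⟩, fun hg => hg.1⟩
    have h2 : SameCycle κ i (ρ i) := hg.sameCycle ⟨1, by simp⟩
    exact (h2.eq_of_left h).symm
  · have hij : i ≠ κ⁻¹ i := fun h' => h (by rw [← Perm.eq_inv_iff_eq]; exact h')
    have hs : SameCycle κ i (κ⁻¹ i) := ⟨-1, by simp⟩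
    rw [geodesic_mul_swap_iff hij hs]
    refine and_congr_right fun hg => ⟨fun h2 => ?_, fun h2 => ?_⟩
    · have hg2 := (geodesic_mul_swap_iff hij hs).2 ⟨hg, h2⟩
      have h3 : SameCycle (κ * swap i (κ⁻¹ i)) i (ρ i) := hg2.sameCycle ⟨1, by simp⟩
      refine (h3.eq_of_left ?_).symm
      simp [Function.IsFixedPt]
    · refine SameCycle.symm ⟨1, ?_⟩
      rw [zpow_one, Perm.mul_apply, Perm.inv_eq_iff_eq, h2]
      simp

/-- Cutting both permutations at the same pair adds one cycle to each and conjugates `ρ⁻¹ * κ`. -/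
theorem geodesic_mul_swap_swap {ρ κ : Perm V} {i j : V} (hij : i ≠ j) (hρ : SameCycle ρ i j)
    (hκ : SameCycle κ i j) : Geodesic (ρ * swap i j) (κ * swap i j) ↔ Geodesic ρ κ := by
  have h1 := numCycles_mul_swap_of_sameCycle hij hρ
  have h2 := numCycles_mul_swap_of_sameCycle hij hκ
  have h3 : (ρ * swap i j)⁻¹ * (κ * swap i j) = swap i j * (ρ⁻¹ * κ) * (swap i j)⁻¹ := by
    simp [mul_assoc]
  rw [Geodesic, Geodesic, h1, h2, h3, numCycles_conj]
  omega

/-- The weight of a cycle of length `n` in the Möbius function. -/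
def signedCatalan (n : ℕ) : ℤ := (-1) ^ (n - 1) * (catalan (n - 1) : ℤ)

theorem signedCatalan_one : signedCatalan 1 = 1 := by simp [signedCatalan]

theorem signedCatalan_eq_neg_sum {k : ℕ} (hk : 1 < k) :
    signedCatalan k = -∑ b ∈ Finset.Ico 1 k, signedCatalan (k - b) * signedCatalan b := by
  obtain ⟨n, rfl⟩ : ∃ n, k = n + 2 := ⟨k - 2, by omega⟩
  rw [Finset.sum_Ico_eq_sum_range, signedCatalan, show n + 2 - 1 = n + 1 by omega, catalan_succ,
    ← Finset.sum_range (fun i => catalan i * catalan (n - i))]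
  push_cast
  rw [Finset.mul_sum, ← Finset.sum_neg_distrib]
  refine Finset.sum_congr rfl fun i hi => ?_
  rw [Finset.mem_range] at hi
  rw [signedCatalan, signedCatalan, show n + 2 - (1 + i) - 1 = n - i by omega,
    show 1 + i - 1 = i by omega]
  have : (-1 : ℤ) ^ (n + 1) = -((-1) ^ (n - i) * (-1) ^ i) := by
    rw [← pow_add, Nat.sub_add_cancel (by omega), pow_succ]
    ring
  rw [this]
  ring

/-- This form of the recursion matches the count of geodesics `ρ` by the value at a point `i`: the
isolated term is `ρ i = i`, the term of index `b` is `ρ i = κ ^ b i`. -/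
theorem catalan_eq_sum_Ico (k : ℕ) :
    catalan (k + 1) = catalan k +
      ∑ b ∈ Finset.Ico 1 (k + 1), catalan (b - 1) * catalan (k + 1 - b) := by
  rw [catalan_succ, ← Finset.sum_range (fun i => catalan i * catalan (k - i)),
    Finset.sum_range_succ, Finset.sum_Ico_eq_sum_range, add_comm]
  congr 1
  · simp
  · refine Finset.sum_congr rfl fun i hi => ?_
    congr 2 <;> omega

-- Choose a point `i` moved by `κ` and separate the `ρ` that fix `i` from those that do not. Both
-- parts reduce to permutations obtained by cutting `κ`, and they cancel.
open Classical in
theorem sum_geodesic_signedCatalan (κ : Perm V) :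
    ∑ ρ : Perm V with Geodesic ρ κ, cycleProd signedCatalan ρ = if κ = 1 then 1 else 0 := by
  induction hn : Fintype.card V - numCycles κ using Nat.strong_induction_on generalizing κ with
  | _ n ih =>
  by_cases hκ : κ = 1
  · subst hκ
    simp only [geodesic_one_right_iff, if_true]
    rw [Finset.filter_eq' Finset.univ (1 : Perm V)]
    simp [cycleProd_one _ signedCatalan_one]
  obtain ⟨i, hi⟩ : ∃ i, κ i ≠ i := by
    by_contra! h
    exact hκ (Equiv.ext h)
  have hlt : ∀ j, i ≠ j → SameCycle κ i j →
      ∑ ρ : Perm V with Geodesic ρ (κ * swap i j), cycleProd signedCatalan ρ =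
        if κ * swap i j = 1 then 1 else 0 := by
    intro j hij hs
    have h1 := numCycles_mul_swap_of_sameCycle hij hs
    have h2 := numCycles_le_card (κ * swap i j)
    exact ih _ (by omega) _ rfl
  rw [if_neg hκ, ← Finset.sum_filter_add_sum_filter_not _ (fun ρ : Perm V => ρ i = i)]
  rw [Finset.filter_filter, Finset.filter_filter]
  simp only [← geodesic_remove_iff]
  have hij : i ≠ κ⁻¹ i := fun h' => hi (by rw [← Perm.eq_inv_iff_eq]; exact h')
  rw [hlt _ hij ⟨-1, by simp⟩]
  -- The Catalan recursion writes the weight of the cycle of `i` as minus a sum over the ways to cut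
  -- it. Cutting `ρ` and `κ` at the same pair then exchanges the two summations.
  have step : ∑ ρ : Perm V with Geodesic ρ κ ∧ ¬ ρ i = i, cycleProd signedCatalan ρ =
      -∑ j ∈ (orbit κ i).erase i, ∑ ρ : Perm V with Geodesic ρ (κ * swap i j),
        cycleProd signedCatalan ρ := by
    have e1 : ∀ ρ ∈ Finset.univ.filter (fun ρ : Perm V => Geodesic ρ κ ∧ ¬ ρ i = i),
        cycleProd signedCatalan ρ =
          -∑ j ∈ (orbit ρ i).erase i, cycleProd signedCatalan (ρ * swap i j) := by
      intro ρ hρ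
      have hk : 1 < (orbit ρ i).card := by
        have := card_orbit_pos ρ i
        have := mt card_orbit_eq_one.1 (Finset.mem_filter.1 hρ).2.2
        omega
      rw [sum_orbit_erase, cycleProd_eq_mul_restProd _ ρ i, signedCatalan_eq_neg_sum hk, neg_mul,
        Finset.sum_mul]
      congr 1
      refine Finset.sum_congr rfl fun b hb => ?_
      rw [Finset.mem_Ico] at hb
      rw [cycleProd_mul_swap _ (by omega) hb.2, mul_assoc]
    rw [Finset.sum_congr rfl e1, Finset.sum_neg_distrib]
    congr 1
    rw [Finset.sum_sigma', Finset.sum_sigma']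
    refine Finset.sum_bij' (fun x _ => ⟨x.2, x.1 * swap i x.2⟩) (fun x _ => ⟨x.2 * swap i x.1, x.1⟩)
      ?_ ?_ ?_ ?_ ?_
    · rintro ⟨ρ, j⟩ h
      simp only [Finset.mem_sigma, Finset.mem_filter, Finset.mem_univ, true_and, Finset.mem_erase,
        mem_orbit] at h ⊢
      have := h.1.1.sameCycle h.2.2
      exact ⟨⟨h.2.1, this⟩, (geodesic_mul_swap_swap h.2.1.symm h.2.2 this).2 h.1.1⟩
    · rintro ⟨j, ρ⟩ h
      simp only [Finset.mem_sigma, Finset.mem_filter, Finset.mem_univ, true_and, Finset.mem_erase,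
        mem_orbit] at h ⊢
      have h1 : ¬ SameCycle ρ i j := fun h' =>
        not_sameCycle_mul_swap h.1.1.symm h.1.2 (h.2.sameCycle h')
      have h2 := sameCycle_mul_swap h1
      refine ⟨⟨?_, fun h3 => h.1.1.symm (h2.eq_of_left h3)⟩, h.1.1, h2⟩
      rw [← geodesic_mul_swap_swap h.1.1.symm h2 h.1.2, mul_swap_mul_self]
      exact h.2
    · rintro ⟨ρ, j⟩ h
      simp
    · rintro ⟨ρ, j⟩ h
      simp
    · rintro ⟨ρ, j⟩ h
      rfl
  -- By induction the inner sum vanishes unless `κ * swap i j = 1`. Only `j = κ⁻¹ i` can satisfy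
  -- this, and its term cancels the contribution of the `ρ` that fix `i`.
  rw [step, Finset.sum_congr rfl (g := fun j => if κ * swap i j = 1 then 1 else 0),
    Finset.sum_eq_single (κ⁻¹ i)]
  · simp
  · intro j hj hne
    rw [if_neg]
    intro h
    apply hne
    rw [mul_eq_one_iff_eq_inv, swap_inv] at h
    rw [h, swap_inv, swap_apply_left]
  · intro h
    exact absurd (Finset.mem_erase.2 ⟨hij.symm, mem_orbit.2 ⟨-1, by simp⟩⟩) h
  · intro j hj
    rw [Finset.mem_erase, mem_orbit] at hj
    exact hlt j hj.1.symm hj.2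

-- Sort the geodesics by `ρ i`, which lies in the cycle of `i` under `κ`. Left multiplication by
-- `swap i (ρ i)` reduces every case to geodesics that fix `i` below a shorter permutation, and the
-- cycle lengths reproduce the Catalan recursion.
open Classical in
theorem card_geodesic (κ : Perm V) :
    (Finset.univ.filter fun ρ : Perm V => Geodesic ρ κ).card = cycleProd catalan κ := by
  induction hn : Fintype.card V - numCycles κ using Nat.strong_induction_on generalizing κ with
  | _ n ih =>
  by_cases hκ : κ = 1
  · subst hκ
    simp only [geodesic_one_right_iff]
    rw [Finset.filter_eq' Finset.univ (1 : Perm V)]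
    simp [cycleProd_one]
  obtain ⟨i, hi⟩ : ∃ i, κ i ≠ i := by
    by_contra! h
    exact hκ (Equiv.ext h)
  have hk : 1 < (orbit κ i).card := by
    have := card_orbit_pos κ i
    have := mt card_orbit_eq_one.1 hi
    omega
  rw [Finset.card_eq_sum_card_fiberwise (f := fun ρ : Perm V => ρ i) (t := orbit κ i)]
  swap
  · intro ρ hρ
    rw [Finset.mem_coe, Finset.mem_filter] at hρ
    exact mem_orbit.2 (hρ.2.sameCycle ⟨1, by simp⟩)
  simp only [Finset.filter_filter]
  rw [← Finset.add_sum_erase _ _ (mem_orbit.2 (SameCycle.refl κ i))]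
  simp only [← geodesic_remove_iff]
  have hij : i ≠ κ⁻¹ i := fun h' => hi (by rw [← Perm.eq_inv_iff_eq]; exact h')
  have hremove : numCycles κ < numCycles (κ * swap i (κ⁻¹ i)) := by
    rw [numCycles_mul_swap_of_sameCycle hij ⟨-1, by simp⟩]
    omega
  have hle := numCycles_le_card (κ * swap i (κ⁻¹ i))
  rw [ih _ (by omega) _ rfl, cycleProd_remove _ catalan_zero catalan_one]
  have key : ∀ j ∈ (orbit κ i).erase i,
      (Finset.univ.filter fun ρ : Perm V => Geodesic ρ κ ∧ ρ i = j).card =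
        cycleProd catalan (swap i j * κ * swap i ((swap i j * κ)⁻¹ i)) := by
    intro j hj
    rw [Finset.mem_erase, mem_orbit] at hj
    have hc : numCycles (swap i j * κ) = numCycles κ + 1 := by
      rw [numCycles_mul_comm, numCycles_mul_swap_of_sameCycle hj.1.symm hj.2]
    have hc2 : numCycles (swap i j * κ) ≤ numCycles (swap i j * κ * swap i ((swap i j * κ)⁻¹ i)) := by
      rcases eq_or_ne i ((swap i j * κ)⁻¹ i) with h | h
      · rw [← h, swap_self, ← Perm.one_def, mul_one]
      · rw [numCycles_mul_swap_of_sameCycle h ⟨-1, by simp⟩]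
        omega
    have hle := numCycles_le_card (swap i j * κ * swap i ((swap i j * κ)⁻¹ i))
    rw [← ih _ (by omega) _ rfl]
    simp only [geodesic_remove_iff]
    have geo : ∀ ρ : Perm V, SameCycle ρ i j →
        (Geodesic (swap i j * ρ) (swap i j * κ) ↔ Geodesic ρ κ) := by
      intro ρ hρ
      have h1 : numCycles (swap i j * ρ) = numCycles ρ + 1 := by
        rw [numCycles_mul_comm, numCycles_mul_swap_of_sameCycle hj.1.symm hρ]
      have h2 : (swap i j * ρ)⁻¹ * (swap i j * κ) = ρ⁻¹ * κ := by group
      rw [Geodesic, Geodesic, h1, h2, hc]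
      omega
    refine Finset.card_bij' (fun ρ _ => swap i j * ρ) (fun ρ _ => swap i j * ρ) ?_ ?_ ?_ ?_
    · intro ρ hρ
      simp only [Finset.mem_filter, Finset.mem_univ, true_and] at hρ ⊢
      refine ⟨(geo ρ ⟨1, by simpa using hρ.2⟩).2 hρ.1, ?_⟩
      rw [Perm.mul_apply, hρ.2, swap_apply_right]
    · intro ρ hρ
      simp only [Finset.mem_filter, Finset.mem_univ, true_and] at hρ ⊢
      have h2 : (swap i j * ρ) i = j := by rw [Perm.mul_apply, hρ.2, swap_apply_left]
      refine ⟨(geo (swap i j * ρ) ⟨1, by simpa using h2⟩).1 ?_, h2⟩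
      rw [swap_mul_self_mul]
      exact hρ.1
    · intro ρ _
      exact swap_mul_self_mul _ _ _
    · intro ρ _
      exact swap_mul_self_mul _ _ _
  rw [Finset.sum_congr rfl key, sum_orbit_erase, cycleProd_eq_mul_restProd _ κ i]
  have key2 : ∀ b ∈ Finset.Ico 1 (orbit κ i).card,
      cycleProd catalan (swap i ((κ ^ b) i) * κ *
        swap i ((swap i ((κ ^ b) i) * κ)⁻¹ i)) =
        catalan (b - 1) * catalan ((orbit κ i).card - b) * restProd catalan κ i := by
    intro b hb
    rw [Finset.mem_Ico] at hb
    set i' := κ⁻¹ i with hi'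
    have hii : SameCycle κ i i' := ⟨-1, by simp [hi']⟩
    have ho : orbit κ i' = orbit κ i := (orbit_eq_orbit.2 hii).symm
    -- Moving the transposition across `κ` shifts both points back by one step. This is the reason
    -- for `i' = κ⁻¹ i`; the product becomes a right-hand cut into pieces of lengths `b` and `k -
    -- b`.
    have hconj : swap i ((κ ^ b) i) * κ = κ * swap i' ((κ ^ b) i') := by
      have h1 : κ i' = i := by simp [hi']
      have h2 : κ ((κ ^ b) i') = (κ ^ b) i := by
        rw [← Perm.mul_apply, ← pow_succ', pow_succ, Perm.mul_apply, h1]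
      rw [mul_swap_eq_swap_mul, h1, h2]
    rw [cycleProd_remove _ catalan_zero catalan_one, hconj]
    have hc := card_orbit_mul_swap (a := κ) (i := i') (b := b) (by omega) (by rw [ho]; exact hb.2)
    set j' := (κ ^ b) i' with hj'
    have hne : i' ≠ j' := (pow_apply_ne (a := κ) (i := i') (c := 0) (b := b) (by rw [ho]; exact hb.2)
      (card_orbit_pos _ _) (by omega)).symm
    have hs : SameCycle κ i' j' := ⟨b, by simp [hj']⟩
    have hji : SameCycle (κ * swap i' j') i j' := by
      refine SameCycle.symm ⟨1, ?_⟩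
      simp [hi']
    rw [orbit_eq_orbit.2 hji, restProd_congr _ hji, hc.1, swap_comm, restProd_mul_swap _ hne.symm hs.symm,
      swap_comm, hc.2, ho, restProd_congr _ (hs.symm.trans hii.symm), mul_assoc]
  rw [Finset.sum_congr rfl key2, ← Finset.sum_mul, ← add_mul]
  congr 1
  have := catalan_eq_sum_Ico ((orbit κ i).card - 1)
  rw [Nat.sub_add_cancel (by omega)] at this
  exact this.symm

/-- `cycleType` omits fixed points, hence the requirement `w 1 = 1`. -/
theorem prod_map_cycleType {M : Type*} [CommMonoid M] (w : ℕ → M) (h1 : w 1 = 1) (a : Perm V) :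
    (a.cycleType.map w).prod = cycleProd w a := by
  rw [cycleType_def, Multiset.map_map, cycleProd]
  change ∏ c ∈ a.cycleFactorsFinset, w c.support.card = _
  refine Finset.prod_of_injOn support ?_ ?_ ?_ (fun _ _ => rfl)
  · intro c hc d hd h
    rw [Finset.mem_coe] at hc hd
    obtain ⟨x, hx⟩ := (mem_cycleFactorsFinset_iff.1 hc).1.nonempty_support
    rw [cycle_is_cycleOf hx hc, cycle_is_cycleOf (show x ∈ d.support from h ▸ hx) hd]
  · intro c hc
    rw [Finset.mem_coe] at hc
    obtain ⟨x, hx⟩ := (mem_cycleFactorsFinset_iff.1 hc).1.nonempty_support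
    have hxa : x ∈ a.support := mem_cycleFactorsFinset_support_le hc hx
    rw [Finset.mem_coe, mem_cycles]
    refine ⟨x, ?_⟩
    rw [cycle_is_cycleOf hx hc]
    ext y
    rw [mem_orbit, mem_support_cycleOf_iff]
    exact ⟨fun h => ⟨h, hxa⟩, fun h => h.1⟩
  · intro b hb hb'
    obtain ⟨x, rfl⟩ := mem_cycles.1 hb
    have hx : a x = x := by
      by_contra hx
      refine hb' ⟨cycleOf a x, ?_, ?_⟩
      · rw [Finset.mem_coe, cycleOf_mem_cycleFactorsFinset_iff]
        exact mem_support.2 hx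
      · ext y
        rw [mem_orbit, mem_support_cycleOf_iff]
        exact ⟨fun h => h.1, fun h => ⟨h, mem_support.2 hx⟩⟩
    rw [card_orbit_eq_one.2 hx, h1]

end WishartMarginals

/-! ### Non-crossing partitions as permutations -/

namespace WishartMarginals

open Equiv Equiv.Perm

/-- A permutation whose cycles are the blocks of a non-crossing partition, each traversed in
increasing order. -/
structure IsNCPerm {m : ℕ} (a : Perm (Fin m)) : Prop where
  nonCrossing : IsNonCrossingRel (SameCycle a)
  -- Together, `up` and `down` say that `a x` is the next larger element of the cycle, or the
  -- smallest one when `x` is the largest. Fixed points fall under `down`.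
  up : ∀ x y, SameCycle a x y → x < a x → y ≤ x ∨ a x ≤ y
  down : ∀ x y, SameCycle a x y → a x ≤ x → a x ≤ y ∧ y ≤ x

variable {m : ℕ}

theorem IsNCPerm.ext {a b : Perm (Fin m)} (ha : IsNCPerm a) (hb : IsNCPerm b)
    (h : ∀ x y, SameCycle a x y ↔ SameCycle b x y) : a = b := by
  refine Equiv.ext fun x => ?_
  have h1 : SameCycle a x (a x) := ⟨1, by simp⟩
  have h2 : SameCycle b x (b x) := ⟨1, by simp⟩
  have h3 := ha.up x (b x) ((h _ _).2 h2)
  have h4 := ha.down x (b x) ((h _ _).2 h2)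
  have h5 := hb.up x (a x) ((h _ _).1 h1)
  have h6 := hb.down x (a x) ((h _ _).1 h1)
  generalize a x = u at *
  generalize b x = v at *
  clear h1 h2 h ha hb
  grind

theorem sameCycle_apply_self (a : Perm (Fin m)) (x : Fin m) : SameCycle a x (a x) := ⟨1, by simp⟩

/-- Cutting a cycle of a non-crossing permutation. -/
theorem IsNCPerm.sameCycle_cut {a : Perm (Fin m)} (ha : IsNCPerm a) {i j : Fin m} (hij : i < j)
    (hs : SameCycle a i j) (x y : Fin m) :
    SameCycle (a * swap i j) x y ↔
      SameCycle a x y ∧ (SameCycle a i x → ((i < x ∧ x ≤ j) ↔ (i < y ∧ y ≤ j))) := by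
  -- The cut separates the points of the cycle in `(i, j]` from the others. For this direction it
  -- suffices that a single step of the new permutation preserves the two sides.
  have main : ∀ x y, SameCycle (a * swap i j) x y →
      SameCycle a x y ∧ (SameCycle a i x → ((i < x ∧ x ≤ j) ↔ (i < y ∧ y ≤ j))) := by
    intro x y
    let r : Setoid (Fin m) :=
      { r := fun x y => SameCycle a x y ∧ (SameCycle a i x → ((i < x ∧ x ≤ j) ↔ (i < y ∧ y ≤ j)))
        iseqv :=
        { refl := fun x => ⟨SameCycle.refl _ _, fun _ => Iff.rfl⟩
          symm := fun h => ⟨h.1.symm, fun h' => (h.2 (h'.trans h.1.symm)).symm⟩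
          trans := fun h k => ⟨h.1.trans k.1, fun h' => (h.2 h').trans (k.2 (h'.trans h.1))⟩ } }
    suffices hstep : ∀ x, r x ((a * swap i j) x) from fun hxy => sameCycle_setoid_le hstep hxy
    intro x
    refine ⟨sameCycle_of_mul_swap hs (sameCycle_apply_self _ x), fun hx => ?_⟩
    by_cases h1 : x = i
    · subst h1
      have e : (a * swap x j) x = a j := by simp
      rw [e]
      have k1 := ha.up j x hs.symm
      have k2 := ha.down j x hs.symm
      generalize a j = u at *
      clear ha r
      grind
    by_cases h2 : x = j
    · subst h2
      have e : (a * swap i x) x = a i := by simp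
      rw [e]
      have k1 := ha.up i x hs
      have k2 := ha.down i x hs
      generalize a i = u at *
      clear ha r
      grind
    · have e : (a * swap i j) x = a x := by simp [swap_apply_of_ne_of_ne h1 h2]
      rw [e]
      have k1 := ha.up x i hx.symm
      have k2 := ha.down x i hx.symm
      have k3 := ha.up x j (hx.symm.trans hs)
      have k4 := ha.down x j (hx.symm.trans hs)
      generalize a x = u at *
      clear ha r
      grind
  refine ⟨main x y, fun ⟨h1, h2⟩ => ?_⟩
  by_cases hx : SameCycle a i x
  · have hy : SameCycle a i y := hx.trans h1
    have h3 := h2 hx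
    -- Every point of the old cycle is joined to `i` or to `j`, and membership in `(i, j]` decides
    -- which.
    have side : ∀ z, SameCycle a i z →
        ((i < z ∧ z ≤ j) ∧ SameCycle (a * swap i j) j z) ∨
        (¬ (i < z ∧ z ≤ j) ∧ SameCycle (a * swap i j) i z) := by
      intro z hz
      rcases sameCycle_mul_swap_or (j := j) hz.symm with h | h
      · right
        refine ⟨fun h' => ?_, h.symm⟩
        have := ((main _ _ h).2 hz).1 h'
        exact lt_irrefl _ this.1
      · left
        exact ⟨((main _ _ h).2 hz).2 ⟨hij, le_rfl⟩, h.symm⟩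
    rcases side x hx with ⟨h4, h5⟩ | ⟨h4, h5⟩ <;> rcases side y hy with ⟨h6, h7⟩ | ⟨h6, h7⟩
    · exact h5.symm.trans h7
    · exact absurd (h3.1 h4) h6
    · exact absurd (h3.2 h6) h4
    · exact h5.symm.trans h7
  · exact (sameCycle_mul_swap_iff hs fun h => hx h.symm).2 h1

theorem IsNCPerm.cut_of_lt {a : Perm (Fin m)} (ha : IsNCPerm a) {i j : Fin m} (hij : i < j)
    (hs : SameCycle a i j) : IsNCPerm (a * swap i j) := by
  have key := ha.sameCycle_cut hij hs
  refine ⟨?_, ?_, ?_⟩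
  · intro p q r s hpq hqr hrs hpr hqs
    rw [key] at hpr hqs ⊢
    have h := ha.nonCrossing p q r s hpq hqr hrs hpr.1 hqs.1
    refine ⟨h, fun hp => ?_⟩
    have h1 := hpr.2 hp
    have h2 := hqs.2 (hp.trans h)
    clear key ha
    grind
  all_goals
    intro x y hxy
    rw [key] at hxy
    obtain ⟨h0, hI⟩ := hxy
    by_cases h1 : x = i
    · subst h1
      have e : (a * swap x j) x = a j := by simp
      rw [e]
      have k0 := hI (SameCycle.refl _ _)
      have k1 := ha.up j x hs.symm
      have k2 := ha.down j x hs.symm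
      have k3 := ha.up j y (hs.symm.trans h0)
      have k4 := ha.down j y (hs.symm.trans h0)
      generalize a j = u at *
      clear ha key
      grind
    by_cases h2 : x = j
    · subst h2
      have e : (a * swap i x) x = a i := by simp
      rw [e]
      have k0 := hI hs
      have k1 := ha.up i x hs
      have k2 := ha.down i x hs
      have k3 := ha.up i y (hs.trans h0)
      have k4 := ha.down i y (hs.trans h0)
      generalize a i = u at *
      clear ha key
      grind
    · have e : (a * swap i j) x = a x := by simp [swap_apply_of_ne_of_ne h1 h2]
      rw [e]
      have k1 := ha.up x y h0
      have k2 := ha.down x y h0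
      assumption

theorem IsNCPerm.cut {a : Perm (Fin m)} (ha : IsNCPerm a) {i j : Fin m} (hij : i ≠ j)
    (hs : SameCycle a i j) : IsNCPerm (a * swap i j) := by
  rcases lt_or_gt_of_ne hij with h | h
  · exact ha.cut_of_lt h hs
  · rw [swap_comm]
    exact ha.cut_of_lt h hs.symm

theorem IsNCPerm.of_geodesic {a κ : Perm (Fin m)} (hκ : IsNCPerm κ) (h : Geodesic a κ) :
    IsNCPerm a :=
  h.induction hκ fun _ _ _ hij hs hb => hb.cut hij hs

/-- The `σ`-cycle through `y` has all its points between `π x` and `y`; any other `σ`-cycle leaving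
`(x, y]` would cross it. -/
theorem IsNCPerm.mem_Ioc_of_lt {σ π : Perm (Fin m)} (hσ : IsNCPerm σ) (hπ : IsNCPerm π)
    (h : ∀ x y, SameCycle σ x y → SameCycle π x y) {x y p q : Fin m} (hy : σ y = π x)
    (hs : SameCycle π x y) (hp : SameCycle π x p) (hpq : SameCycle σ p q)
    (hI : x < p ∧ p ≤ y) : x < q ∧ q ≤ y := by
  have hu := sameCycle_apply_self σ y
  have k1 := hπ.up x y hs
  have k2 := hπ.down x y hs
  have k3 := hπ.up x p hp
  have k4 := hπ.up x q (hp.trans (h _ _ hpq))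
  rw [hy] at hu
  generalize hgu : π x = u at *
  by_cases hyp : SameCycle σ y p
  · have k5 := hσ.down y q (hyp.trans hpq)
    rw [hy] at k5
    clear hu h
    grind
  · have hpy : p ≠ y := fun e => hyp (e ▸ SameCycle.refl _ _)
    have hpu : p ≠ u := fun e => hyp (e ▸ hu)
    have n1 := hσ.nonCrossing u p y q
    have n2 := hσ.nonCrossing q u p y
    have hqu : ¬ SameCycle σ q u := fun e => hyp (hu.trans (hpq.trans e).symm)
    have hup : ¬ SameCycle σ u p := fun e => hyp (hu.trans e)
    have := hu.symm
    have := hpq.symm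
    have hqy : q ≠ y := fun e => hyp (e ▸ hpq.symm)
    grind

/-- Here the `σ`-cycle through `y` has no point in `(y, x]`, since `σ y = π x` is the cyclic
successor of `y`; a cycle leaving that interval would cross it. -/
theorem IsNCPerm.mem_Ioc_of_gt {σ π : Perm (Fin m)} (hσ : IsNCPerm σ) (hπ : IsNCPerm π)
    (h : ∀ x y, SameCycle σ x y → SameCycle π x y) {x y p q : Fin m} (hy : σ y = π x)
    (_hyx : y < x) (hs : SameCycle π x y) (hp : SameCycle π x p) (hpq : SameCycle σ p q)
    (hI : y < p ∧ p ≤ x) : y < q ∧ q ≤ x := by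
  have hu := sameCycle_apply_self σ y
  have k2 := hπ.down x y hs
  have k4 := hπ.up x q (hp.trans (h _ _ hpq))
  have k5 := hπ.down x q (hp.trans (h _ _ hpq))
  rw [hy] at hu
  have hyp : ¬ SameCycle σ y p := by
    intro hyp
    have k6 := hσ.up y p hyp
    have k7 := hσ.down y p hyp
    rw [hy] at k6 k7
    generalize π x = u at *
    clear hu h
    grind
  generalize hgu : π x = u at *
  have hqu : ¬ SameCycle σ q u := fun e => hyp (hu.trans (hpq.trans e).symm)
  have hqy : ¬ SameCycle σ q y := fun e => hyp (hpq.trans e).symm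
  have hqy' : q ≠ y := fun e => hqy (e ▸ SameCycle.refl _ _)
  have hqu' : q ≠ u := fun e => hqu (e ▸ SameCycle.refl _ _)
  have hup : ¬ SameCycle σ u p := fun e => hyp (hu.trans e)
  have n1 := hσ.nonCrossing q y p u
  have n2 := hσ.nonCrossing y p u q
  have n3 := hσ.nonCrossing u q y p
  have hqu2 : ¬ SameCycle σ u q := fun e => hqu e.symm
  have := hu.symm
  have := hpq.symm
  grind

/-- Unless `σ = π`, a cycle of `π` can be cut while the cycles of `σ` still refine the result;
induct on the number of cuts still possible. -/
theorem IsNCPerm.geodesic_of_le {σ π : Perm (Fin m)} (hσ : IsNCPerm σ) (hπ : IsNCPerm π)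
    (h : ∀ x y, SameCycle σ x y → SameCycle π x y) : Geodesic σ π := by
  induction hn : m - numCycles π using Nat.strong_induction_on generalizing π with
  | _ n ih =>
  by_cases hne : σ = π
  · exact hne ▸ Geodesic.refl σ
  obtain ⟨x, hx⟩ : ∃ x, σ x ≠ π x := by
    by_contra! h
    exact hne (Equiv.ext h)
  -- Cutting `π` at `x` and this `y` makes it send `y` to `π x = σ y`, so the cut permutation agrees
  -- with `σ` at `y`.
  set y := σ⁻¹ (π x) with hy
  have hσy : σ y = π x := by simp [hy]
  have hyx : x ≠ y := fun e => hx (by rw [← hσy, ← e])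
  have hxu := sameCycle_apply_self π x
  have hyu := sameCycle_apply_self σ y
  have hs : SameCycle π x y := hxu.trans (hσy ▸ h _ _ hyu.symm)
  have hcut : ∀ p q, SameCycle σ p q → SameCycle (π * swap x y) p q := by
    intro p q hpq
    have hpq' := h p q hpq
    rcases lt_or_gt_of_ne hyx with hlt | hlt
    · rw [hπ.sameCycle_cut hlt hs]
      refine ⟨hpq', fun hp => ⟨?_, ?_⟩⟩
      · exact hσ.mem_Ioc_of_lt hπ h hσy hs hp hpq
      · exact hσ.mem_Ioc_of_lt hπ h hσy hs (hp.trans hpq') hpq.symm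
    · rw [swap_comm, hπ.sameCycle_cut hlt hs.symm]
      refine ⟨hpq', fun hp => ⟨?_, ?_⟩⟩
      · exact hσ.mem_Ioc_of_gt hπ h hσy hlt hs (hs.trans hp) hpq
      · exact hσ.mem_Ioc_of_gt hπ h hσy hlt hs (hs.trans (hp.trans hpq')) hpq.symm
  have h1 := numCycles_mul_swap_of_sameCycle hyx hs
  have h2 := numCycles_le_card (π * swap x y)
  rw [Fintype.card_fin] at h2
  have h3 := ih _ (by omega) (hπ.cut hyx hs) hcut rfl
  exact ((geodesic_mul_swap_iff hyx hs).1 h3).1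


/-! ### The long cycle -/

theorem sameCycle_finRotate (x y : Fin m) : SameCycle (finRotate m) x y := by
  rcases m with _ | n
  · exact x.elim0
  have h0 : ∀ k (hk : k < n + 1), SameCycle (finRotate (n + 1)) 0 ⟨k, hk⟩ := by
    intro k
    induction k with
    | zero => exact fun _ => SameCycle.refl _ _
    | succ k ih =>
      intro hk
      refine (ih (by omega)).trans ⟨1, ?_⟩
      rw [zpow_one, finRotate_of_lt (by omega)]
  exact (h0 x x.2).symm.trans (h0 y y.2)

theorem isNCPerm_finRotate (m : ℕ) : IsNCPerm (finRotate m) := by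
  rcases m with _ | n
  · exact ⟨fun a => a.elim0, fun a => a.elim0, fun a => a.elim0⟩
  have hval : ∀ x : Fin (n + 1), ((finRotate (n + 1) x : Fin (n + 1)) : ℕ) =
      if x.1 = n then 0 else x.1 + 1 := by
    intro x
    split_ifs with h
    · have : x = Fin.last n := Fin.ext h
      rw [this, finRotate_last]
      rfl
    · rw [coe_finRotate_of_ne_last]
      exact fun e => h (by rw [e]; rfl)
  refine ⟨fun a b c d _ _ _ _ _ => sameCycle_finRotate _ _, fun x y _ h => ?_, fun x y _ h => ?_⟩
  · have := hval x
    simp only [Fin.lt_def, Fin.le_def] at *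
    split_ifs at this <;> omega
  · have := hval x
    simp only [Fin.le_def] at *
    split_ifs at this <;> omega

theorem numCycles_finRotate (n : ℕ) : numCycles (finRotate (n + 1)) = 1 := by
  rw [numCycles, numClasses, Nat.card_eq_one_iff_unique]
  refine ⟨⟨fun p q => ?_⟩, ⟨Quotient.mk _ 0⟩⟩
  induction p using Quotient.inductionOn with | _ x => ?_
  induction q using Quotient.inductionOn with | _ y => ?_
  exact Quotient.sound (sameCycle_finRotate x y)

/-! ### The permutation of a non-crossing partition -/

/-- The cycles attached to the other blocks fix `x`. -/
theorem noncommProd_formPerm_apply (P : Finpartition (Finset.univ : Finset (Fin m))) (comm)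
    (x : Fin m) : P.parts.noncommProd (fun b => (b.sort (· ≤ ·)).formPerm) comm x =
      ((P.part x).sort (· ≤ ·)).formPerm x := by
  have hx : P.part x ∈ P.parts := P.part_mem.2 (Finset.mem_univ x)
  rw [← Finset.mul_noncommProd_erase _ hx, Perm.mul_apply]
  congr 1
  refine Finset.noncommProd_induction _ _ _ (fun τ : Perm (Fin m) => τ x = x) ?_ rfl ?_
  · intro a b ha hb
    rw [Perm.mul_apply, hb, ha]
  · intro b hb
    rw [Finset.mem_erase] at hb
    refine List.formPerm_apply_of_notMem fun h => hb.1 ?_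
    rw [Finset.mem_sort] at h
    exact (P.part_eq_of_mem hb.2 h).symm

theorem toPerm_apply (σ : NC m) (x : Fin m) :
    toPerm σ x = ((σ.1.part x).sort (· ≤ ·)).formPerm x :=
  noncommProd_formPerm_apply σ.1 _ x

theorem sort_formPerm (b : Finset (Fin m)) {x : Fin m} (hx : x ∈ b) :
    ∃ (i j : ℕ) (hi : i < (b.sort (· ≤ ·)).length) (hj : j < (b.sort (· ≤ ·)).length),
      (b.sort (· ≤ ·))[i] = x ∧ (b.sort (· ≤ ·))[j] = (b.sort (· ≤ ·)).formPerm x ∧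
      j = (i + 1) % (b.sort (· ≤ ·)).length := by
  obtain ⟨i, hi, rfl⟩ := List.getElem_of_mem ((Finset.mem_sort (· ≤ ·)).2 hx)
  refine ⟨i, _, hi, Nat.mod_lt _ (by omega), rfl, ?_, rfl⟩
  rw [List.formPerm_apply_getElem _ (Finset.sort_nodup _ _)]

theorem sort_getElem_lt_iff (b : Finset (Fin m)) {i j : ℕ} (hi : i < (b.sort (· ≤ ·)).length)
    (hj : j < (b.sort (· ≤ ·)).length) :
    (b.sort (· ≤ ·))[i] ≤ (b.sort (· ≤ ·))[j] ↔ i ≤ j := by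
  have := (Finset.sortedLT_sort b).strictMono_get.le_iff_le (a := ⟨i, hi⟩) (b := ⟨j, hj⟩)
  simpa using this

theorem sameBlock_toPerm_apply (σ : NC m) (x : Fin m) : SameBlock σ.1 x (toPerm σ x) := by
  rw [toPerm_apply, SameBlock, ← Finset.mem_sort (· ≤ ·)]
  exact List.formPerm_apply_mem_of_mem ((Finset.mem_sort _).2 (sameBlock_refl _ _))

/-- The setoid of a partition. -/
def blockSetoid (σ : NC m) : Setoid (Fin m) where
  r := SameBlock σ.1
  iseqv := ⟨sameBlock_refl _, sameBlock_symm, sameBlock_trans⟩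

theorem sameCycle_toPerm (σ : NC m) (x y : Fin m) :
    SameCycle (toPerm σ) x y ↔ SameBlock σ.1 x y := by
  constructor
  · intro h
    exact (sameCycle_setoid_le (r := blockSetoid σ) (sameBlock_toPerm_apply σ)) h
  · intro h
    set l := (σ.1.part x).sort (· ≤ ·) with hl
    have hnod : l.Nodup := Finset.sort_nodup _ _
    have hstep : ∀ k (hk : k + 1 < l.length), SameCycle (toPerm σ) (l[k]) (l[k + 1]) := by
      intro k hk
      refine ⟨1, ?_⟩
      have hmem : l[k] ∈ σ.1.part x := (Finset.mem_sort (· ≤ ·)).1 (List.getElem_mem _)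
      have hpart : σ.1.part l[k] = σ.1.part x :=
        σ.1.part_eq_of_mem (σ.1.part_mem.2 (Finset.mem_univ x)) hmem
      rw [zpow_one, toPerm_apply, hpart]
      exact List.formPerm_apply_lt_getElem _ hnod _ hk
    have h0 : ∀ k (hk : k < l.length), SameCycle (toPerm σ) (l[0]) (l[k]) := by
      intro k
      induction k with
      | zero => exact fun _ => SameCycle.refl _ _
      | succ k ih => exact fun hk => (ih (by omega)).trans (hstep k hk)
    obtain ⟨i, hi, hiy⟩ := List.getElem_of_mem ((Finset.mem_sort (· ≤ ·)).2 h)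
    obtain ⟨j, hj, hjx⟩ := List.getElem_of_mem
      ((Finset.mem_sort (· ≤ ·)).2 (sameBlock_refl σ.1 x))
    have h1 := (h0 j hj).symm.trans (h0 i hi)
    rwa [hjx, hiy] at h1

theorem isNCPerm_toPerm (σ : NC m) : IsNCPerm (toPerm σ) := by
  refine ⟨?_, ?_, ?_⟩
  · have : SameCycle (toPerm σ) = SameBlock σ.1 := by
      ext x y
      exact sameCycle_toPerm σ x y
    rw [this]
    exact σ.2
  all_goals
    intro x y hxy h
    rw [sameCycle_toPerm] at hxy
    rw [toPerm_apply] at h ⊢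
    obtain ⟨i, j, hi, hj, hix, hjx, hij⟩ := sort_formPerm (σ.1.part x) (sameBlock_refl σ.1 x)
    obtain ⟨k, hk, hky⟩ := List.getElem_of_mem ((Finset.mem_sort (· ≤ ·)).2 hxy)
    rw [← hjx] at h ⊢
    have e1 := sort_getElem_lt_iff (σ.1.part x) hi hj
    have e2 := sort_getElem_lt_iff (σ.1.part x) hj hi
    have e3 := sort_getElem_lt_iff (σ.1.part x) hk hi
    have e4 := sort_getElem_lt_iff (σ.1.part x) hj hk
    rw [hix] at e1 e2 e3
    rw [hky] at e3 e4
    rw [← not_le] at *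
    rcases Nat.lt_or_ge (i + 1) ((σ.1.part x).sort (· ≤ ·)).length with hlt | hge
    · rw [Nat.mod_eq_of_lt hlt] at hij
      rw [e2] at h
      rw [e3, e4]
      omega
    · rw [show i + 1 = ((σ.1.part x).sort (· ≤ ·)).length by omega, Nat.mod_self] at hij
      rw [e2] at h
      rw [e3, e4]
      omega

/-! ### Refinement and the geodesic order -/

theorem nc_le_iff {σ π : NC m} : σ ≤ π ↔ ∀ x y, SameBlock σ.1 x y → SameBlock π.1 x y := by
  constructor
  · intro h x y hxy
    obtain ⟨c, hc, hle⟩ := (show σ.1 ≤ π.1 from h) (σ.1.part_mem.2 (Finset.mem_univ x))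
    have hx : x ∈ c := hle (sameBlock_refl σ.1 x)
    rw [SameBlock, π.1.part_eq_of_mem hc hx]
    exact hle hxy
  · intro h
    change σ.1 ≤ π.1
    intro b hb
    obtain ⟨i, hi⟩ := σ.1.nonempty_of_mem_parts hb
    refine ⟨π.1.part i, π.1.part_mem.2 (Finset.mem_univ i), fun j hj => h i j ?_⟩
    rw [SameBlock, σ.1.part_eq_of_mem hb hi]
    exact hj

theorem nc_ext {σ π : NC m} (h : ∀ x y, SameBlock σ.1 x y ↔ SameBlock π.1 x y) : σ = π :=
  le_antisymm (nc_le_iff.2 fun x y => (h x y).1) (nc_le_iff.2 fun x y => (h x y).2)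

open Classical in
/-- The non-crossing partition into the classes of a non-crossing equivalence relation. -/
def NC.ofSetoid (r : Setoid (Fin m)) (hr : IsNonCrossingRel r) : NC m :=
  ⟨Finpartition.ofSetoid r, by
    have : SameBlock (Finpartition.ofSetoid r) = r := by
      ext x y
      rw [SameBlock, Finpartition.mem_part_ofSetoid_iff_rel]
    rw [this]
    exact hr⟩

theorem NC.sameBlock_ofSetoid {r : Setoid (Fin m)} {hr : IsNonCrossingRel r} {x y : Fin m} :
    SameBlock (NC.ofSetoid r hr).1 x y ↔ r x y := by
  classical
  rw [NC.ofSetoid, SameBlock, Finpartition.mem_part_ofSetoid_iff_rel]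

theorem IsNCPerm.exists_toPerm {a : Perm (Fin m)} (ha : IsNCPerm a) : ∃ σ : NC m, toPerm σ = a := by
  refine ⟨NC.ofSetoid (SameCycle.setoid a) ha.nonCrossing, (isNCPerm_toPerm _).ext ha fun x y => ?_⟩
  rw [sameCycle_toPerm, NC.sameBlock_ofSetoid]
  rfl

theorem toPerm_injective : Function.Injective (toPerm : NC m → Perm (Fin m)) := by
  intro σ π h
  refine nc_ext fun x y => ?_
  rw [← sameCycle_toPerm, ← sameCycle_toPerm, h]

theorem geodesic_toPerm_iff {σ π : NC m} : Geodesic (toPerm σ) (toPerm π) ↔ σ ≤ π := by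
  rw [nc_le_iff]
  simp only [← sameCycle_toPerm]
  exact ⟨fun h x y => h.sameCycle, (isNCPerm_toPerm σ).geodesic_of_le (isNCPerm_toPerm π)⟩

/-- The whole lattice of non-crossing partitions is the geodesic interval below the long cycle,
because everything geodesically below a non-crossing permutation is non-crossing. -/
theorem geodesic_finRotate_iff {a : Perm (Fin m)} :
    Geodesic a (finRotate m) ↔ ∃ σ : NC m, toPerm σ = a := by
  constructor
  · exact fun h => ((isNCPerm_finRotate m).of_geodesic h).exists_toPerm
  · rintro ⟨σ, rfl⟩
    exact (isNCPerm_toPerm σ).geodesic_of_le (isNCPerm_finRotate m)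
      fun x y _ => sameCycle_finRotate x y

theorem cycles_toPerm (σ : NC m) : cycles (toPerm σ) = σ.1.parts := by
  have h : ∀ x, orbit (toPerm σ) x = σ.1.part x := fun x => by
    ext y
    rw [mem_orbit, sameCycle_toPerm, SameBlock]
  ext b
  rw [mem_cycles]
  constructor
  · rintro ⟨x, rfl⟩
    rw [h]
    exact σ.1.part_mem.2 (Finset.mem_univ x)
  · intro hb
    obtain ⟨i, hi⟩ := σ.1.nonempty_of_mem_parts hb
    exact ⟨i, by rw [h, σ.1.part_eq_of_mem hb hi]⟩

/-! ### The Möbius function and the size of a principal ideal -/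

theorem exists_toPerm_of_geodesic {ρ : Perm (Fin m)} {π : NC m} (h : Geodesic ρ (toPerm π)) :
    ∃ σ : NC m, toPerm σ = ρ ∧ σ ≤ π := by
  obtain ⟨σ, rfl⟩ := ((isNCPerm_toPerm π).of_geodesic h).exists_toPerm
  exact ⟨σ, rfl, geodesic_toPerm_iff.1 h⟩

open Classical in
theorem card_filter_le (π : NC m) :
    (Finset.univ.filter fun σ : NC m => σ ≤ π).card = ∏ b ∈ π.1.parts, catalan b.card := by
  rw [← cycles_toPerm, ← cycleProd, ← card_geodesic]
  refine Finset.card_bij (fun σ _ => toPerm σ) ?_ (fun _ _ _ _ h => toPerm_injective h) ?_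
  · intro σ hσ
    simpa [geodesic_toPerm_iff] using hσ
  · intro ρ hρ
    obtain ⟨σ, rfl, hσ⟩ := exists_toPerm_of_geodesic (Finset.mem_filter.1 hρ).2
    exact ⟨σ, by simpa using hσ, rfl⟩

/-- Left translation by the inverse of `toPerm σ` maps the interval onto the geodesics below
`(toPerm σ)⁻¹ * toPerm π`, where the sum is known. -/
theorem sum_Icc_signedCatalan {σ π : NC m} (h : σ ≤ π) :
    ∑ τ ∈ Finset.Icc σ π, cycleProd signedCatalan ((toPerm σ)⁻¹ * toPerm τ) =
      if σ = π then 1 else 0 := by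
  classical
  have h1 : (toPerm σ)⁻¹ * toPerm π = 1 ↔ σ = π := by
    rw [inv_mul_eq_one, toPerm_injective.eq_iff]
  simp only [← h1]
  rw [← sum_geodesic_signedCatalan]
  refine Finset.sum_bij (fun τ _ => (toPerm σ)⁻¹ * toPerm τ) ?_ ?_ ?_ (fun _ _ => rfl)
  · intro τ hτ
    rw [Finset.mem_Icc] at hτ
    rw [Finset.mem_filter]
    exact ⟨Finset.mem_univ _, (geodesic_toPerm_iff.2 hτ.1).translate (geodesic_toPerm_iff.2 hτ.2)
      (geodesic_toPerm_iff.2 h)⟩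
  · intro τ _ τ' _ e
    exact toPerm_injective (mul_left_cancel e)
  · intro ρ hρ
    have hρ' := (Finset.mem_filter.1 hρ).2
    have h2 := (geodesic_toPerm_iff.2 h).trans (τ := toPerm σ * ρ) (by rwa [inv_mul_cancel_left])
    obtain ⟨τ, hτ, hle⟩ := exists_toPerm_of_geodesic h2.1
    rw [← hτ] at h2
    exact ⟨τ, Finset.mem_Icc.2 ⟨geodesic_toPerm_iff.1 h2.2, hle⟩, by rw [hτ, inv_mul_cancel_left]⟩

theorem signedCatalanProd_eq (τ : Perm (Fin m)) :
    signedCatalanProd τ = cycleProd signedCatalan τ :=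
  prod_map_cycleType signedCatalan signedCatalan_one τ

/-- Both sides have the same sum over every interval starting at `σ`, and the term at the top is
determined by those below it. -/
theorem mob_eq_signedCatalanProd {σ π : NC m} (h : σ ≤ π) :
    mob σ π = signedCatalanProd ((toPerm σ)⁻¹ * toPerm π) := by
  rw [signedCatalanProd_eq]
  induction hn : (Finset.Icc σ π).card using Nat.strong_induction_on generalizing π with
  | _ n ih =>
  have h1 := sum_Icc_signedCatalan h
  have h2 := IncidenceAlgebra.sum_Icc_mu_right (𝕜 := ℤ) σ π
  rw [← Finset.Ico_insert_right h, Finset.sum_insert Finset.right_notMem_Ico] at h1 h2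
  have h3 : ∑ τ ∈ Finset.Ico σ π, IncidenceAlgebra.mu ℤ σ τ =
      ∑ τ ∈ Finset.Ico σ π, cycleProd signedCatalan ((toPerm σ)⁻¹ * toPerm τ) := by
    refine Finset.sum_congr rfl fun τ hτ => ?_
    rw [Finset.mem_Ico] at hτ
    refine ih _ ?_ hτ.1 rfl
    rw [← hn]
    refine Finset.card_lt_card (Finset.ssubset_iff_subset_ne.2 ⟨Finset.Icc_subset_Icc_right hτ.2.le, ?_⟩)
    intro e
    have : π ∈ Finset.Icc σ τ := e ▸ Finset.right_mem_Icc.2 h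
    exact absurd (Finset.mem_Icc.1 this).2 hτ.2.not_ge
  rw [mob]
  rw [h3] at h2
  exact add_right_cancel (h2.trans h1.symm)

end WishartMarginals

/-! ### Counting two-coloured non-crossing partitions -/

namespace WishartMarginals

variable {m p : ℕ}

/-- The points of `Fin p` are coloured by `c` and sent to the positions `g`, in such a way that
`x ↦ (g x, c x)` is monotone for the lexicographic order. -/
def IsColoring (g : Fin p → Fin m) (c : Fin p → Bool) : Prop :=
  ∀ x y, x ≤ y → g x < g y ∨ (g x = g y ∧ (c x = true → c y = true))

/-- The pullback of `σ` to the points of colour `b`, completed by singletons. -/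
def pullbackSetoid (g : Fin p → Fin m) (c : Fin p → Bool) (b : Bool) (σ : NC m) :
    Setoid (Fin p) where
  r x y := x = y ∨ (c x = b ∧ c y = b ∧ SameBlock σ.1 (g x) (g y))
  iseqv :=
    { refl := fun x => Or.inl rfl
      symm := by
        rintro x y (h | ⟨h, h', h''⟩)
        · exact Or.inl h.symm
        · exact Or.inr ⟨h', h, sameBlock_symm h''⟩
      trans := by
        rintro x y z (rfl | ⟨h, h', h''⟩) (rfl | ⟨k, k', k''⟩)
        · exact Or.inl rfl
        · exact Or.inr ⟨k, k', k''⟩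
        · exact Or.inr ⟨h, h', h''⟩
        · exact Or.inr ⟨h, k', sameBlock_trans h'' k''⟩ }

theorem IsColoring.monotone {g : Fin p → Fin m} {c : Fin p → Bool} (hgc : IsColoring g c) :
    Monotone g := fun x y h => (hgc x y h).elim le_of_lt fun h => h.1.le

theorem isNonCrossingRel_pullbackSetoid {g : Fin p → Fin m} {c : Fin p → Bool}
    (hg : Monotone g) (b : Bool) (σ : NC m) :
    IsNonCrossingRel (pullbackSetoid g c b σ) := by
  rintro x y z w hxy hyz hzw (h | ⟨h1, h2, h3⟩) (k | ⟨k1, k2, k3⟩)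
  · exact absurd h (hxy.trans hyz).ne
  · exact absurd h (hxy.trans hyz).ne
  · exact absurd k (hyz.trans hzw).ne
  refine Or.inr ⟨h1, k1, ?_⟩
  rcases (hg hxy.le).lt_or_eq with e1 | e1
  · rcases (hg hyz.le).lt_or_eq with e2 | e2
    · rcases (hg hzw.le).lt_or_eq with e3 | e3
      · exact σ.2 _ _ _ _ e1 e2 e3 h3 k3
      · rw [← e3] at k3
        exact sameBlock_trans h3 (sameBlock_symm k3)
    · rwa [e2]
  · rw [e1]
    exact sameBlock_refl _ _

/-- The pullback of `σ` to the points of colour `b`, completed by singletons. -/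
def pullbackNC {g : Fin p → Fin m} {c : Fin p → Bool} (hg : Monotone g) (b : Bool) (σ : NC m) :
    NC p := NC.ofSetoid (pullbackSetoid g c b σ) (isNonCrossingRel_pullbackSetoid hg b σ)

theorem parts_eq_part {P : Finpartition (Finset.univ : Finset (Fin m))} {b : Finset (Fin m)} :
    b ∈ P.parts ↔ ∃ x, P.part x = b := by
  constructor
  · intro hb
    obtain ⟨i, hi⟩ := P.nonempty_of_mem_parts hb
    exact ⟨i, P.part_eq_of_mem hb hi⟩
  · rintro ⟨x, rfl⟩
    exact P.part_mem.2 (Finset.mem_univ x)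

/-- A principal ideal has a product of Catalan numbers as its size, and the blocks of the pullback
are the coloured fibres over the blocks of `σ`, together with singletons. -/
theorem card_le_pullbackNC {g : Fin p → Fin m} {c : Fin p → Bool} (hg : Monotone g) (b : Bool)
    (σ : NC m) :
    (open Classical in (Finset.univ.filter fun β : NC p => β ≤ pullbackNC (c := c) hg b σ).card) =
      catProd σ fun i => (Finset.univ.filter fun x => g x = i ∧ c x = b).card := by
  classical
  rw [card_filter_le, catProd]
  have hsum : ∀ B : Finset (Fin m), ∑ i ∈ B, (Finset.univ.filter fun x => g x = i ∧ c x = b).card =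
      (Finset.univ.filter fun x => g x ∈ B ∧ c x = b).card := by
    intro B
    rw [Finset.card_eq_sum_card_fiberwise (f := g) (t := B)]
    · refine Finset.sum_congr rfl fun i hi => ?_
      congr 1
      ext x
      simp only [Finset.mem_filter, Finset.mem_univ, true_and]
      constructor
      · rintro ⟨rfl, h⟩
        exact ⟨⟨hi, h⟩, rfl⟩
      · rintro ⟨⟨_, h⟩, rfl⟩
        exact ⟨rfl, h⟩
    · intro x hx
      simp only [Finset.coe_filter, Finset.mem_univ, true_and, Set.mem_ofPred_eq] at hx
      exact hx.1
  simp only [hsum]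
  have hblock : ∀ x y, SameBlock (pullbackNC (c := c) hg b σ).1 x y ↔
      (x = y ∨ (c x = b ∧ c y = b ∧ SameBlock σ.1 (g x) (g y))) := fun x y =>
    NC.sameBlock_ofSetoid
  have hpart : ∀ x, c x = b → (pullbackNC (c := c) hg b σ).1.part x =
      Finset.univ.filter fun y => g y ∈ σ.1.part (g x) ∧ c y = b := by
    intro x hx
    ext y
    change SameBlock _ x y ↔ _
    rw [hblock]
    simp only [Finset.mem_filter, Finset.mem_univ, true_and]
    constructor
    · rintro (rfl | h)
      · exact ⟨sameBlock_refl _ _, hx⟩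
      · exact ⟨h.2.2, h.2.1⟩
    · exact fun h => Or.inr ⟨hx, h.2, h.1⟩
  symm
  -- Blocks of `σ` with an empty coloured fibre and singletons of the other colour have no
  -- counterpart, but contribute `catalan 0 = catalan 1 = 1`.
  refine Finset.prod_bij_ne_one
    (fun B _ _ => Finset.univ.filter fun x => g x ∈ B ∧ c x = b) ?_ ?_ ?_ (fun _ _ _ => rfl)
  · intro B hB hne
    have : (Finset.univ.filter fun x => g x ∈ B ∧ c x = b).Nonempty := by
      rw [Finset.nonempty_iff_ne_empty]
      intro h
      rw [h] at hne
      simp at hne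
    obtain ⟨x, hx⟩ := this
    simp only [Finset.mem_filter, Finset.mem_univ, true_and] at hx
    rw [parts_eq_part]
    exact ⟨x, by rw [hpart x hx.2, σ.1.part_eq_of_mem hB hx.1]⟩
  · intro B hB hne B' hB' _ h
    have : (Finset.univ.filter fun x => g x ∈ B ∧ c x = b).Nonempty := by
      rw [Finset.nonempty_iff_ne_empty]
      intro h
      rw [h] at hne
      simp at hne
    obtain ⟨x, hx⟩ := this
    have hx' := hx
    rw [h] at hx'
    simp only [Finset.mem_filter, Finset.mem_univ, true_and] at hx hx'
    rw [← σ.1.part_eq_of_mem hB hx.1, σ.1.part_eq_of_mem hB' hx'.1]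
  · intro D hD hne
    obtain ⟨x, rfl⟩ := parts_eq_part.1 hD
    have hx : c x = b := by
      by_contra hx
      have : (pullbackNC (c := c) hg b σ).1.part x = {x} := by
        ext y
        change SameBlock _ x y ↔ _
        rw [hblock, Finset.mem_singleton]
        constructor
        · rintro (h | h)
          · exact h.symm
          · exact absurd h.1 hx
        · exact fun h => Or.inl h.symm
      rw [this] at hne
      simp at hne
    rw [hpart x hx] at hne
    exact ⟨σ.1.part (g x), σ.1.part_mem.2 (Finset.mem_univ _), hne, (hpart x hx).symm⟩

/-- All nontrivial blocks of `β` have colour `b`. -/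
def IsPure (c : Fin p → Bool) (b : Bool) (β : NC p) : Prop :=
  ∀ x y, SameBlock β.1 x y → x ≠ y → c x = b ∧ c y = b

/-- Every block of `α` has a single colour. -/
def IsMono (c : Fin p → Bool) (α : NC p) : Prop := ∀ x y, SameBlock α.1 x y → c x = c y

/-- `i` and `j` do not separate `k` from `l`. -/
def NotSep (i j k l : Fin m) : Prop := ((i ≤ k) ↔ (j ≤ k)) ↔ ((i ≤ l) ↔ (j ≤ l))

/-- No pair of `δ` separates a pair of `β`. -/
def Compatible (g : Fin p → Fin m) (β δ : NC p) : Prop :=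
  ∀ x y u v, SameBlock β.1 x y → x ≠ y → SameBlock δ.1 u v → u ≠ v →
    NotSep (g u) (g v) (g x) (g y)

theorem le_pullbackNC_iff {g : Fin p → Fin m} {c : Fin p → Bool} (hg : Monotone g) {b : Bool}
    {σ : NC m} {β : NC p} : β ≤ pullbackNC (c := c) hg b σ ↔
      IsPure c b β ∧ ∀ x y, SameBlock β.1 x y → x ≠ y → SameBlock σ.1 (g x) (g y) := by
  rw [nc_le_iff]
  have hblock : ∀ x y, SameBlock (pullbackNC (c := c) hg b σ).1 x y ↔
      (x = y ∨ (c x = b ∧ c y = b ∧ SameBlock σ.1 (g x) (g y))) := fun x y =>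
    NC.sameBlock_ofSetoid
  simp only [hblock, IsPure]
  constructor
  · intro h
    constructor
    · intro x y hxy hne
      have := (h x y hxy).resolve_left hne
      exact ⟨this.1, this.2.1⟩
    · exact fun x y hxy hne => ((h x y hxy).resolve_left hne).2.2
  · rintro ⟨h, h'⟩ x y hxy
    by_cases hne : x = y
    · exact Or.inl hne
    · exact Or.inr ⟨(h x y hxy hne).1, (h x y hxy hne).2, h' x y hxy hne⟩

/-- The partition of `Fin m` generated by the images of the pairs of `β`. -/
def closureNC (g : Fin p → Fin m) (β : NC p) : NC m :=
  NC.ofSetoid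
    { r := fun k l => ∀ σ : NC m, (∀ x y, SameBlock β.1 x y → x ≠ y → SameBlock σ.1 (g x) (g y)) →
        SameBlock σ.1 k l
      iseqv :=
      { refl := fun _ _ _ => sameBlock_refl _ _
        symm := fun h σ hσ => sameBlock_symm (h σ hσ)
        trans := fun h k σ hσ => sameBlock_trans (h σ hσ) (k σ hσ) } }
    (fun _ _ _ _ h1 h2 h3 h4 h5 σ hσ => σ.2 _ _ _ _ h1 h2 h3 (h4 σ hσ) (h5 σ hσ))

theorem closureNC_le_iff {g : Fin p → Fin m} {β : NC p} {σ : NC m} :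
    closureNC g β ≤ σ ↔ ∀ x y, SameBlock β.1 x y → x ≠ y → SameBlock σ.1 (g x) (g y) := by
  rw [nc_le_iff]
  constructor
  · intro h x y hxy hne
    exact h _ _ (NC.sameBlock_ofSetoid.2 fun σ' hσ' => hσ' x y hxy hne)
  · intro h x y hxy
    exact NC.sameBlock_ofSetoid.1 hxy σ h

/-- The two-class partition cut out by a pair of companion points. -/
def sepNC (i j : Fin m) : NC m :=
  NC.ofSetoid
    { r := NotSep i j
      iseqv :=
      { refl := fun _ => by unfold NotSep; tauto
        symm := fun h => by unfold NotSep at *; tauto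
        trans := fun h k => by unfold NotSep at *; tauto } }
    (fun a b c d h1 h2 h3 (h4 : NotSep i j a c) (h5 : NotSep i j b d) => by
      change NotSep i j a b
      unfold NotSep at *
      simp only [Fin.le_def, Fin.lt_def] at *
      omega)

/-- The Kreweras relation must hold for all pairs of the generated partition, compatibility only for
the generating pairs. They agree because not being separated by a fixed pair is itself a
non-crossing partition, `sepNC`, so the closure lies below it. -/
theorem compatible_iff {g : Fin p → Fin m} {β δ : NC p} : Compatible g β δ ↔
    ∀ u v, SameBlock δ.1 u v → u ≠ v → SameBlock (kreweras (closureNC g β)).1 (g u) (g v) := by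
  simp only [sameBlock_kreweras]
  constructor
  · intro h u v huv hne
    have hle : closureNC g β ≤ sepNC (g u) (g v) := closureNC_le_iff.2 fun x y hxy hxy' =>
      NC.sameBlock_ofSetoid.2 (h x y u v hxy hxy' huv hne)
    intro x y hxy
    exact NC.sameBlock_ofSetoid.1 (nc_le_iff.1 hle x y hxy)
  · intro h x y u v hxy hne huv hne'
    exact h u v huv hne' (g x) (g y) (closureNC_le_iff.1 le_rfl x y hxy hne)

/-! ### Splitting a two-coloured partition into its colours -/

/-- The blocks of colour `b` of `α`, completed by singletons. -/
def restrictNC (c : Fin p → Bool) (b : Bool) (α : NC p) : NC p :=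
  pullbackNC (g := id) (c := c) monotone_id b α

theorem sameBlock_restrictNC {c : Fin p → Bool} {b : Bool} {α : NC p} {x y : Fin p} :
    SameBlock (restrictNC c b α).1 x y ↔ x = y ∨ (c x = b ∧ c y = b ∧ SameBlock α.1 x y) :=
  NC.sameBlock_ofSetoid (hr := isNonCrossingRel_pullbackSetoid monotone_id b α)

/-- At each position the points of colour `false` precede those of colour `true`, just as `ī`
precedes `i`. The weak comparison of positions used in `krewerasSetoid` is therefore the strict
order of points. -/
theorem IsColoring.lt_iff {g : Fin p → Fin m} {c : Fin p → Bool} (hgc : IsColoring g c)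
    {u x : Fin p} (hu : c u = false) (hx : c x = true) : g u ≤ g x ↔ u < x := by
  have h1 := hgc u x
  have h2 := hgc x u
  rw [hu, hx] at h1 h2
  simp only [Fin.le_def, Fin.lt_def, Fin.ext_iff] at *
  constructor
  · intro h
    by_contra hlt
    have := h2 (by omega)
    simp at this
    omega
  · intro h
    have := h1 (by omega)
    omega

theorem compatible_restrictNC {g : Fin p → Fin m} {c : Fin p → Bool} (hgc : IsColoring g c)
    {α : NC p} (hα : IsMono c α) :
    Compatible g (restrictNC c true α) (restrictNC c false α) := by
  intro x y u v hxy hne huv hne'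
  obtain ⟨hx, hy, hxy⟩ := (sameBlock_restrictNC.1 hxy).resolve_left hne
  obtain ⟨hu, hv, huv⟩ := (sameBlock_restrictNC.1 huv).resolve_left hne'
  rw [NotSep, hgc.lt_iff hu hx, hgc.lt_iff hv hx, hgc.lt_iff hu hy, hgc.lt_iff hv hy]
  have hn : ∀ {z w}, c z = true → c w = false → ¬ SameBlock α.1 z w := fun h1 h2 h3 => by
    have := hα _ _ h3
    rw [h1, h2] at this
    cases this
  have hn' : ∀ {z w}, c z = false → c w = true → ¬ SameBlock α.1 z w := fun h1 h2 h3 =>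
    hn h2 h1 (sameBlock_symm h3)
  have hyx := sameBlock_symm hxy
  have hvu := sameBlock_symm huv
  have a1 := fun h1 h2 h3 => hn hx hu (α.2 x u y v h1 h2 h3 hxy huv)
  have a2 := fun h1 h2 h3 => hn hx hv (α.2 x v y u h1 h2 h3 hxy hvu)
  have a3 := fun h1 h2 h3 => hn hy hu (α.2 y u x v h1 h2 h3 hyx huv)
  have a4 := fun h1 h2 h3 => hn hy hv (α.2 y v x u h1 h2 h3 hyx hvu)
  have b1 := fun h1 h2 h3 => hn' hu hx (α.2 u x v y h1 h2 h3 huv hxy)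
  have b2 := fun h1 h2 h3 => hn' hu hy (α.2 u y v x h1 h2 h3 huv hyx)
  have b3 := fun h1 h2 h3 => hn' hv hx (α.2 v x u y h1 h2 h3 hvu hxy)
  have b4 := fun h1 h2 h3 => hn' hv hy (α.2 v y u x h1 h2 h3 hvu hyx)
  have d1 : u ≠ x := fun e => by rw [e, hx] at hu; cases hu
  have d2 : u ≠ y := fun e => by rw [e, hy] at hu; cases hu
  have d3 : v ≠ x := fun e => by rw [e, hx] at hv; cases hv
  have d4 : v ≠ y := fun e => by rw [e, hy] at hv; cases hv
  clear hxy huv hyx hvu hn hn' hα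
  simp only [Fin.lt_def, ne_eq, Fin.ext_iff] at *
  grind

/-- The union of a partition of colour `true` and a compatible partition of colour `false`. -/
def joinNC {g : Fin p → Fin m} {c : Fin p → Bool} (hgc : IsColoring g c) {β δ : NC p}
    (hβ : IsPure c true β) (hδ : IsPure c false δ) (h : Compatible g β δ) : NC p :=
  NC.ofSetoid
    { r := fun x y => SameBlock β.1 x y ∨ SameBlock δ.1 x y
      iseqv :=
      { refl := fun x => Or.inl (sameBlock_refl _ _)
        symm := fun h => h.imp sameBlock_symm sameBlock_symm
        trans := by
          have key : ∀ {x y z}, SameBlock β.1 x y → SameBlock δ.1 y z → x = y ∨ y = z := by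
            intro x y z h1 h2
            by_contra! hne
            have e1 := (hβ _ _ h1 hne.1).2
            have e2 := (hδ _ _ h2 hne.2).1
            rw [e1] at e2
            cases e2
          rintro x y z (h1 | h1) (h2 | h2)
          · exact Or.inl (sameBlock_trans h1 h2)
          · rcases key h1 h2 with rfl | rfl
            · exact Or.inr h2
            · exact Or.inl h1
          · rcases key (sameBlock_symm h2) (sameBlock_symm h1) with rfl | rfl
            · exact Or.inr h1
            · exact Or.inl h2
          · exact Or.inr (sameBlock_trans h1 h2) } }
    (by
      rintro x y z w hxy hyz hzw (h1 | h1) (h2 | h2)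
      · exact Or.inl (β.2 _ _ _ _ hxy hyz hzw h1 h2)
      · exfalso
        obtain ⟨hx, hz⟩ := hβ _ _ h1 (hxy.trans hyz).ne
        obtain ⟨hy, hw⟩ := hδ _ _ h2 (hyz.trans hzw).ne
        have := h _ _ _ _ h1 (hxy.trans hyz).ne h2 (hyz.trans hzw).ne
        rw [NotSep, hgc.lt_iff hy hx, hgc.lt_iff hw hx, hgc.lt_iff hy hz, hgc.lt_iff hw hz] at this
        simp only [Fin.lt_def] at *
        omega
      · exfalso
        obtain ⟨hx, hz⟩ := hδ _ _ h1 (hxy.trans hyz).ne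
        obtain ⟨hy, hw⟩ := hβ _ _ h2 (hyz.trans hzw).ne
        have := h _ _ _ _ h2 (hyz.trans hzw).ne h1 (hxy.trans hyz).ne
        rw [NotSep, hgc.lt_iff hx hy, hgc.lt_iff hz hy, hgc.lt_iff hx hw, hgc.lt_iff hz hw] at this
        simp only [Fin.lt_def] at *
        omega
      · exact Or.inr (δ.2 _ _ _ _ hxy hyz hzw h1 h2))

-- A monochromatic partition is a pair of compatible partitions, one of each colour. For fixed `β`,
-- compatibility says that `δ` refines the pullback of a Kreweras complement, so the choices of `δ`
-- are counted by `card_le_pullbackNC`.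
open Classical in
theorem card_isMono_eq_sum {g : Fin p → Fin m} {c : Fin p → Bool} (hgc : IsColoring g c) :
    (Finset.univ.filter fun α : NC p => IsMono c α).card =
      ∑ β : NC p with IsPure c true β,
        catProd (kreweras (closureNC g β)) fun i =>
          (Finset.univ.filter fun x => g x = i ∧ c x = false).card := by
  have h1 : ∀ β : NC p, (catProd (kreweras (closureNC g β)) fun i =>
      (Finset.univ.filter fun x => g x = i ∧ c x = false).card) =
      (Finset.univ.filter fun δ : NC p => IsPure c false δ ∧ Compatible g β δ).card := by
    intro β
    rw [← card_le_pullbackNC hgc.monotone]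
    congr 1
    ext δ
    simp only [Finset.mem_filter, Finset.mem_univ, true_and, le_pullbackNC_iff, compatible_iff]
  rw [Finset.sum_congr rfl fun β _ => h1 β, ← Finset.card_sigma]
  have hp : ∀ (b : Bool) (α : NC p), IsPure c b (restrictNC c b α) := by
    intro b α x y hxy hne
    obtain ⟨hx, hy, -⟩ := (sameBlock_restrictNC.1 hxy).resolve_left hne
    exact ⟨hx, hy⟩
  refine Finset.card_bij (fun α _ => ⟨restrictNC c true α, restrictNC c false α⟩) ?_ ?_ ?_
  · intro α hα
    simp only [Finset.mem_sigma, Finset.mem_filter, Finset.mem_univ, true_and] at hα ⊢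
    exact ⟨hp _ _, hp _ _, compatible_restrictNC hgc hα⟩
  · intro α hα α' hα' h
    simp only [Finset.mem_filter, Finset.mem_univ, true_and] at hα hα'
    simp only [Sigma.mk.injEq, heq_eq_eq] at h
    have key : ∀ α : NC p, IsMono c α → ∀ x y, SameBlock α.1 x y ↔
        SameBlock (restrictNC c true α).1 x y ∨ SameBlock (restrictNC c false α).1 x y := by
      intro α hα x y
      rw [sameBlock_restrictNC, sameBlock_restrictNC]
      constructor
      · intro hxy
        have := hα x y hxy
        cases hx : c x
        · exact Or.inr (Or.inr ⟨rfl, by rw [← this, hx], hxy⟩)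
        · exact Or.inl (Or.inr ⟨rfl, by rw [← this, hx], hxy⟩)
      · rintro ((rfl | h) | (rfl | h))
        · exact sameBlock_refl _ _
        · exact h.2.2
        · exact sameBlock_refl _ _
        · exact h.2.2
    exact nc_ext fun x y => by rw [key α hα, key α' hα', h.1, h.2]
  · rintro ⟨β, δ⟩ h
    simp only [Finset.mem_sigma, Finset.mem_filter, Finset.mem_univ, true_and] at h
    obtain ⟨hβ, hδ, hcomp⟩ := h
    have hj : ∀ x y, SameBlock (joinNC hgc hβ hδ hcomp).1 x y ↔
        SameBlock β.1 x y ∨ SameBlock δ.1 x y := fun x y => NC.sameBlock_ofSetoid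
    have key : ∀ (b : Bool) (β δ : NC p), IsPure c b β → IsPure c (!b) δ → ∀ x y,
        (x = y ∨ (c x = b ∧ c y = b ∧ (SameBlock β.1 x y ∨ SameBlock δ.1 x y))) ↔
          SameBlock β.1 x y := by
      intro b β δ hβ hδ x y
      constructor
      · rintro (rfl | ⟨hx, -, h | h⟩)
        · exact sameBlock_refl _ _
        · exact h
        · by_cases hne : x = y
          · exact hne ▸ sameBlock_refl _ _
          · have := (hδ x y h hne).1
            rw [hx] at this
            cases b <;> cases this
      · intro h
        by_cases hne : x = y
        · exact Or.inl hne
        · exact Or.inr ⟨(hβ x y h hne).1, (hβ x y h hne).2, Or.inl h⟩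
    refine ⟨joinNC hgc hβ hδ hcomp, ?_, ?_⟩
    · rw [Finset.mem_filter]
      refine ⟨Finset.mem_univ _, fun x y hxy => ?_⟩
      by_cases hne : x = y
      · rw [hne]
      rcases (hj x y).1 hxy with h | h
      · rw [(hβ x y h hne).1, (hβ x y h hne).2]
      · rw [(hδ x y h hne).1, (hδ x y h hne).2]
    · have e1 : restrictNC c true (joinNC hgc hβ hδ hcomp) = β := nc_ext fun x y => by
        rw [sameBlock_restrictNC, hj, key true β δ hβ hδ]
      have e2 : restrictNC c false (joinNC hgc hβ hδ hcomp) = δ := nc_ext fun x y => by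
        rw [sameBlock_restrictNC, hj, or_comm (a := SameBlock β.1 x y), key false δ β hδ hβ]
      rw [e1, e2]

open Classical in
/-- The number of non-crossing partitions with monochromatic blocks. -/
theorem card_isMono {g : Fin p → Fin m} {c : Fin p → Bool} (hgc : IsColoring g c)
    {r s : Fin m → ℕ} (hr : ∀ i, (Finset.univ.filter fun x => g x = i ∧ c x = true).card = r i)
    (hs : ∀ i, (Finset.univ.filter fun x => g x = i ∧ c x = false).card = s i) :
    (((Finset.univ.filter fun α : NC p => IsMono c α).card : ℕ) : ℤ) =
      ∑ σ : NC m, ∑ π : NC m with σ ≤ π,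
        (catProd σ r : ℤ) * (catProd (kreweras π) s : ℤ) * mob σ π := by
  -- `Cat_σ(r)` counts the `β` whose closure lies below `σ`; this is the cumulative count to be
  -- inverted.
  have hcat : ∀ σ : NC m, (catProd σ r : ℤ) = ∑ β : NC p with IsPure c true β,
      if closureNC g β ≤ σ then 1 else 0 := by
    intro σ
    have := card_le_pullbackNC (c := c) hgc.monotone true σ
    simp only [hr] at this
    rw [← this, ← Finset.sum_filter, Finset.filter_filter, Finset.sum_const, nsmul_eq_mul, mul_one]
    congr 2
    ext β
    simp only [Finset.mem_filter, Finset.mem_univ, true_and, le_pullbackNC_iff, closureNC_le_iff]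
  rw [card_isMono_eq_sum hgc]
  simp only [hs]
  push_cast
  have e : ∀ π : NC m, ∑ σ : NC m with σ ≤ π, ∑ β : NC p with IsPure c true β,
      (if closureNC g β ≤ σ then (1 : ℤ) else 0) * (catProd (kreweras π) s : ℤ) * mob σ π =
      ∑ β : NC p with IsPure c true β,
        if closureNC g β = π then (catProd (kreweras π) s : ℤ) else 0 := by
    intro π
    rw [Finset.sum_comm]
    refine Finset.sum_congr rfl fun β _ => ?_
    have h1 : ∀ σ : NC m, (if closureNC g β ≤ σ then (1 : ℤ) else 0) *
        (catProd (kreweras π) s : ℤ) * mob σ π =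
        if closureNC g β ≤ σ then (catProd (kreweras π) s : ℤ) * mob σ π else 0 := by
      intro σ
      split_ifs <;> simp
    simp only [h1]
    rw [← Finset.sum_filter, Finset.filter_filter, ← Finset.mul_sum]
    have h2 : (Finset.univ.filter fun σ : NC m => σ ≤ π ∧ closureNC g β ≤ σ) =
        Finset.Icc (closureNC g β) π := by
      ext σ
      simp [and_comm]
    rw [h2]
    -- Möbius inversion: the sum over `[closure, π]` keeps only the `β` whose closure equals `π`.
    have h3 := IncidenceAlgebra.sum_Icc_mu_left (𝕜 := ℤ) (closureNC g β) π
    unfold mob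
    rw [h3]
    split_ifs <;> simp
  have e' : ∀ π : NC m, ∑ σ : NC m,
      (if σ ≤ π then (catProd σ r : ℤ) * (catProd (kreweras π) s : ℤ) * mob σ π else 0) =
      ∑ β : NC p with IsPure c true β,
        if closureNC g β = π then (catProd (kreweras π) s : ℤ) else 0 := by
    intro π
    rw [← e, ← Finset.sum_filter]
    simp only [hcat, Finset.sum_mul]
  have e'' : ∀ σ : NC m, ∑ π : NC m with σ ≤ π,
      (catProd σ r : ℤ) * (catProd (kreweras π) s : ℤ) * mob σ π = ∑ π : NC m,
      (if σ ≤ π then (catProd σ r : ℤ) * (catProd (kreweras π) s : ℤ) * mob σ π else 0) :=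
    fun σ => by rw [Finset.sum_filter]
  rw [Finset.sum_congr rfl fun σ _ => e'' σ, Finset.sum_comm, Finset.sum_congr rfl fun π _ => e' π,
    Finset.sum_comm]
  refine Finset.sum_congr rfl fun β _ => ?_
  rw [Finset.sum_ite_eq]
  simp

end WishartMarginals

/-! ### Moments of the standard complex Gaussian -/

namespace WishartMarginals

open Equiv ComplexConjugate

/-- A non-integrable function has integral `0` by convention, whereas the Gamma formula gives a
positive value. -/
theorem integrable_rpow_mul_exp_neg_sq (q : ℕ) :
    Integrable (fun z : ℂ => ‖z‖ ^ q * Real.exp (-‖z‖ ^ 2)) := by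
  by_contra h
  have h1 := Complex.integral_rpow_mul_exp_neg_rpow (p := 2) (q := q) (by norm_num)
    (by have : (0 : ℝ) ≤ q := Nat.cast_nonneg q
        linarith)
  have h2 : ∫ z : ℂ, ‖z‖ ^ (q : ℝ) * Real.exp (-‖z‖ ^ (2 : ℝ)) =
      ∫ z : ℂ, ‖z‖ ^ q * Real.exp (-‖z‖ ^ 2) := by
    simp only [Real.rpow_natCast, Real.rpow_two]
  rw [h2, integral_undef h] at h1
  have : 0 < (2 * Real.pi / 2) * Real.Gamma (((q : ℝ) + 2) / 2) := by
    refine mul_pos (by positivity) (Real.Gamma_pos_of_pos (by positivity))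
  linarith

theorem integral_pow_mul_exp_neg_sq (a : ℕ) :
    ∫ z : ℂ, ‖z‖ ^ (2 * a) * Real.exp (-‖z‖ ^ 2) = Real.pi * a.factorial := by
  have h1 := Complex.integral_rpow_mul_exp_neg_rpow (p := 2) (q := (2 * a : ℕ)) (by norm_num)
    (by have : (0 : ℝ) ≤ (2 * a : ℕ) := Nat.cast_nonneg _
        linarith)
  simp only [Real.rpow_natCast, Real.rpow_two] at h1
  rw [h1, show (((2 * a : ℕ) : ℝ) + 2) / 2 = (a : ℝ) + 1 by push_cast; ring,
    Real.Gamma_nat_eq_factorial]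
  ring

theorem measurable_gaussianDensity :
    Measurable (fun z : ℂ => ENNReal.ofReal (Real.pi⁻¹ * Real.exp (-‖z‖ ^ 2))) := by
  fun_prop

theorem integrable_stdComplexGaussian (a b : ℕ) :
    Integrable (fun z : ℂ => z ^ a * conj z ^ b) stdComplexGaussian := by
  unfold stdComplexGaussian
  rw [integrable_withDensity_iff_integrable_smul' measurable_gaussianDensity
    (ae_of_all _ fun _ => ENNReal.ofReal_lt_top)]
  refine ((integrable_rpow_mul_exp_neg_sq (a + b)).const_mul Real.pi⁻¹).mono' ?_ ?_
  · exact Measurable.aestronglyMeasurable (by fun_prop)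
  · refine ae_of_all _ fun z => ?_
    rw [ENNReal.toReal_ofReal (by positivity), norm_smul, Real.norm_of_nonneg (by positivity),
      norm_mul, norm_pow, norm_pow, RCLike.norm_conj, ← pow_add]
    apply le_of_eq
    ring

theorem integral_rotate (a b : ℕ) (c : Circle) :
    ∫ z : ℂ, ((Real.pi⁻¹ * Real.exp (-‖z‖ ^ 2) : ℝ) : ℂ) * (z ^ a * conj z ^ b) =
      (c : ℂ) ^ a * conj (c : ℂ) ^ b *
        ∫ z : ℂ, ((Real.pi⁻¹ * Real.exp (-‖z‖ ^ 2) : ℝ) : ℂ) * (z ^ a * conj z ^ b) := by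
  have h := (rotation c).measurePreserving.integral_comp' (f := (rotation c).toMeasurableEquiv)
    (fun z : ℂ => ((Real.pi⁻¹ * Real.exp (-‖z‖ ^ 2) : ℝ) : ℂ) * (z ^ a * conj z ^ b))
  rw [← integral_const_mul]
  refine h.symm.trans (integral_congr_ae (ae_of_all _ fun z => ?_))
  change ((Real.pi⁻¹ * Real.exp (-‖rotation c z‖ ^ 2) : ℝ) : ℂ) *
    ((rotation c z) ^ a * conj (rotation c z) ^ b) = _
  rw [LinearIsometryEquiv.norm_map, rotation_apply, map_mul, mul_pow, mul_pow]
  ring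

theorem integral_stdComplexGaussian (a b : ℕ) :
    ∫ z : ℂ, z ^ a * conj z ^ b ∂stdComplexGaussian = if a = b then (a.factorial : ℂ) else 0 := by
  unfold stdComplexGaussian
  rw [integral_withDensity_eq_integral_toReal_smul measurable_gaussianDensity
    (ae_of_all _ fun _ => ENNReal.ofReal_lt_top)]
  have h1 : ∀ z : ℂ, (ENNReal.ofReal (Real.pi⁻¹ * Real.exp (-‖z‖ ^ 2))).toReal •
      (z ^ a * conj z ^ b) =
      ((Real.pi⁻¹ * Real.exp (-‖z‖ ^ 2) : ℝ) : ℂ) * (z ^ a * conj z ^ b) := by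
    intro z
    rw [ENNReal.toReal_ofReal (by positivity), Complex.real_smul]
  simp only [h1]
  split_ifs with hab
  · subst hab
    have h2 : ∀ z : ℂ, ((Real.pi⁻¹ * Real.exp (-‖z‖ ^ 2) : ℝ) : ℂ) * (z ^ a * conj z ^ a) =
        ((Real.pi⁻¹ * (‖z‖ ^ (2 * a) * Real.exp (-‖z‖ ^ 2)) : ℝ) : ℂ) := by
      intro z
      rw [← mul_pow, Complex.mul_conj, Complex.normSq_eq_norm_sq, pow_mul]
      push_cast
      ring
    simp only [h2]
    rw [integral_complex_ofReal, integral_const_mul, integral_pow_mul_exp_neg_sq,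
      inv_mul_cancel_left₀ Real.pi_ne_zero]
    simp
  · have hd : ((a : ℝ) - b) ≠ 0 := sub_ne_zero.2 (by exact_mod_cast hab)
    -- Rotation by the angle `π / (a - b)` multiplies the integrand by `exp (iπ) = -1` and preserves
    -- the Gaussian, so the integral equals its own negative.
    have h2 := integral_rotate a b (Circle.exp (Real.pi / ((a : ℝ) - b)))
    have h3 : ((Circle.exp (Real.pi / ((a : ℝ) - b)) : Circle) : ℂ) ^ a *
        conj ((Circle.exp (Real.pi / ((a : ℝ) - b)) : Circle) : ℂ) ^ b = -1 := by
      rw [Circle.coe_exp, ← Complex.exp_conj, ← Complex.exp_nat_mul, ← Complex.exp_nat_mul,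
        ← Complex.exp_add, map_mul, Complex.conj_ofReal, Complex.conj_I, ← Complex.exp_pi_mul_I]
      congr 1
      have hd' : ((a : ℂ) - b) ≠ 0 := by exact_mod_cast hd
      push_cast
      field_simp
      ring
    rw [h3] at h2
    generalize (∫ z : ℂ, ((Real.pi⁻¹ * Real.exp (-‖z‖ ^ 2) : ℝ) : ℂ) * (z ^ a * conj z ^ b)) = I at *
    have h4 : (2 : ℂ) * I = 0 := by linear_combination h2
    simpa using h4

/-! ### Wick calculus -/

/-- An admissible `α` carries each fibre of `u` onto the matching fibre of `v`; given one such `α₀`,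
the others correspond to the stabiliser of `v`. The product has the shape of a joint moment of
independent complex Gaussians, which is the content of Wick's formula. -/
theorem card_perm_comp_eq {K I : Type*} [Fintype K] [DecidableEq K] [Fintype I] [DecidableEq I]
    (u v : K → I) :
    (Finset.univ.filter fun α : Perm K => ∀ k, u k = v (α k)).card =
      ∏ i, if (Finset.univ.filter fun k => u k = i).card = (Finset.univ.filter fun k => v k = i).card
        then (Finset.univ.filter fun k => u k = i).card.factorial else 0 := by
  by_cases h : ∀ i, (Finset.univ.filter fun k => u k = i).card =
      (Finset.univ.filter fun k => v k = i).card
  · simp only [h, if_true]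
    have e : ∀ i, {k // u k = i} ≃ {k // v k = i} := fun i => by
      refine Fintype.equivOfCardEq ?_
      rw [Fintype.card_subtype, Fintype.card_subtype, h]
    set α₀ : Perm K := Equiv.ofFiberEquiv e
    have hα₀ : ∀ k, v (α₀ k) = u k := fun k => Equiv.ofFiberEquiv_map e k
    have h1 := DomMulAct.stabilizer_card v
    simp only [Fintype.card_subtype] at h1
    rw [← h1]
    refine Finset.card_bij' (fun α _ => α * α₀⁻¹) (fun α _ => α * α₀) ?_ ?_ ?_ ?_
    · intro α hα
      simp only [Finset.mem_filter, Finset.mem_univ, true_and] at hα ⊢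
      funext k
      rw [Function.comp_apply, Perm.mul_apply, ← hα, ← hα₀]
      simp
    · intro α hα
      simp only [Finset.mem_filter, Finset.mem_univ, true_and] at hα ⊢
      intro k
      rw [Perm.mul_apply, ← hα₀]
      exact (congrFun hα (α₀ k)).symm
    · intro α _
      simp
    · intro α _
      simp
  · have h' := h
    push Not at h'
    obtain ⟨i, hi⟩ := h'
    rw [Finset.prod_eq_zero (Finset.mem_univ i) (if_neg hi), Finset.card_eq_zero,
      Finset.filter_eq_empty_iff]
    intro α _ hα
    refine hi (Finset.card_bij (fun k _ => α k) ?_ (fun _ _ _ _ h => α.injective h) ?_)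
    · intro k hk
      simp only [Finset.mem_filter, Finset.mem_univ, true_and] at hk ⊢
      rw [← hα, hk]
    · intro k hk
      simp only [Finset.mem_filter, Finset.mem_univ, true_and] at hk
      refine ⟨α⁻¹ k, ?_, by simp⟩
      simp only [Finset.mem_filter, Finset.mem_univ, true_and]
      rw [hα]
      simpa using hk

theorem iIndepFun_integrable_prod {Ω ι : Type*} [MeasurableSpace Ω] {μ : Measure Ω}
    [IsProbabilityMeasure μ] {Y : ι → Ω → ℂ} (hY : iIndepFun Y μ) (hint : ∀ i, Integrable (Y i) μ)
    (s : Finset ι) : Integrable (∏ i ∈ s, Y i) μ := by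
  classical
  induction s using Finset.induction_on with
  | empty =>
    rw [Finset.prod_empty]
    exact integrable_const (1 : ℂ)
  | insert i s hi ih =>
    rw [Finset.prod_insert hi]
    exact (hY.indepFun_finsetProd_of_notMem₀ (fun j => (hint j).aemeasurable) hi).symm.integrable_mul
      (hint i) ih

theorem prod_comp_eq_prod_pow {K I M : Type*} [Fintype K] [Fintype I] [DecidableEq I] [CommMonoid M]
    (u : K → I) (f : I → M) :
    ∏ k, f (u k) = ∏ i, f i ^ (Finset.univ.filter fun k => u k = i).card := by
  rw [← Finset.prod_fiberwise Finset.univ u]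
  refine Finset.prod_congr rfl fun i _ => ?_
  rw [← Finset.prod_const]
  refine Finset.prod_congr rfl fun k hk => ?_
  rw [(Finset.mem_filter.1 hk).2]

section Wick

variable {Ω : Type*} [MeasurableSpace Ω] {P : Measure Ω} [IsProbabilityMeasure P] {a b c d : ℕ}
  {X : Ω → Idx a b c d → ℂ} {K : Type*} [Fintype K]

theorem wick_aux (hX : IsGaussianTensor X P) (n n' : Idx a b c d → ℕ) :
    Integrable (fun ω => ∏ i, (X ω i ^ n i * conj (X ω i) ^ n' i)) P ∧
    ∫ ω, ∏ i, (X ω i ^ n i * conj (X ω i) ^ n' i) ∂P =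
      ∏ i, if n i = n' i then ((n i).factorial : ℂ) else 0 := by
  have hmeas : ∀ i, Measurable (fun z : ℂ => z ^ n i * conj z ^ n' i) := fun i => by fun_prop
  have hindep := hX.indep.comp (fun i (z : ℂ) => z ^ n i * conj z ^ n' i) hmeas
  have hint : ∀ i, Integrable ((fun z : ℂ => z ^ n i * conj z ^ n' i) ∘ fun ω => X ω i) P := by
    intro i
    have := integrable_stdComplexGaussian (n i) (n' i)
    rw [← (hX.hasLaw i).map_eq] at this
    exact this.comp_aemeasurable (hX.hasLaw i).aemeasurable
  constructor
  · have := iIndepFun_integrable_prod hindep hint Finset.univ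
    convert! this using 1
    ext ω
    simp
  · have h1 := hindep.integral_fun_prod_eq_prod_integral fun i => (hint i).aestronglyMeasurable
    refine h1.trans (Finset.prod_congr rfl fun i _ => ?_)
    rw [← integral_stdComplexGaussian, (hX.hasLaw i).integral_comp]
    exact (hmeas i).aestronglyMeasurable

theorem prod_mul_conj_eq (u v : K → Idx a b c d) (x : Idx a b c d → ℂ) :
    ∏ k, (x (u k) * conj (x (v k))) =
      ∏ i, (x i ^ (Finset.univ.filter fun k => u k = i).card *
        conj (x i) ^ (Finset.univ.filter fun k => v k = i).card) := by
  rw [Finset.prod_mul_distrib, Finset.prod_mul_distrib, prod_comp_eq_prod_pow u x,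
    prod_comp_eq_prod_pow v fun i => conj (x i)]

theorem integrable_wick (hX : IsGaussianTensor X P) (u v : K → Idx a b c d) :
    Integrable (fun ω => ∏ k, (X ω (u k) * conj (X ω (v k)))) P := by
  simp only [prod_mul_conj_eq]
  exact (wick_aux hX _ _).1

/-- Wick's formula. -/
theorem integral_wick [DecidableEq K] (hX : IsGaussianTensor X P) (u v : K → Idx a b c d) :
    ∫ ω, ∏ k, (X ω (u k) * conj (X ω (v k))) ∂P =
      ((Finset.univ.filter fun α : Perm K => ∀ k, u k = v (α k)).card : ℂ) := by
  simp only [prod_mul_conj_eq]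
  rw [(wick_aux hX _ _).2, card_perm_comp_eq]
  push_cast
  rfl

end Wick

end WishartMarginals

/-! ### Traces of words as sums over closed paths -/

namespace WishartMarginals

open Equiv Equiv.Perm ComplexConjugate

theorem ofFn_reverse_prod_apply {I : Type*} [Fintype I] [DecidableEq I] {n : ℕ}
    (A : Fin n → Matrix I I ℂ) (y z : I) :
    (List.ofFn A).reverse.prod y z = ∑ x : Fin (n + 1) → I,
      if x 0 = z ∧ x (Fin.last n) = y then ∏ k : Fin n, A k (x k.succ) (x k.castSucc) else 0 := by
  induction n generalizing y z with
  | zero =>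
    rw [← (Equiv.funUnique (Fin 1) I).symm.sum_comp]
    simp only [List.ofFn_zero, List.reverse_nil, List.prod_nil, Matrix.one_apply,
      Finset.univ_eq_empty, Finset.prod_empty]
    simp only [Equiv.funUnique_symm_apply, uniqueElim_const]
    rw [Finset.sum_congr rfl (g := fun x => if x = z then (if y = z then (1 : ℂ) else 0) else 0)]
    · simp
    · intro x _
      by_cases h : x = z
      · subst h
        simp [eq_comm]
      · simp [h]
  | succ n ih =>
    rw [List.ofFn_succ, List.reverse_cons, List.prod_append, List.prod_singleton, Matrix.mul_apply]
    simp only [ih]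
    rw [← (Fin.consEquiv fun _ : Fin (n + 2) => I).sum_comp, Fintype.sum_prod_type]
    simp only [Fin.consEquiv_apply, Fin.cons_zero, ← Fin.succ_last, Fin.cons_succ,
      Fin.prod_univ_succ, Fin.castSucc_zero, ← Fin.succ_castSucc, Finset.sum_mul]
    rw [Finset.sum_comm, Finset.sum_comm (s := (Finset.univ : Finset I))]
    refine Finset.sum_congr rfl fun x _ => ?_
    rw [Finset.sum_eq_single (x 0), Finset.sum_eq_single z]
    · simp only [true_and]
      split_ifs
      · ring
      · simp
    · intro w _ hw
      simp [hw]
    · simp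
    · intro w _ hw
      simp [hw.symm]
    · simp

/-- The trace identifies the two ends of the path, and `finRotate` is the successor with the
resulting wrap-around. -/
theorem trace_ofFn_reverse_prod {I : Type*} [Fintype I] [DecidableEq I] {n : ℕ}
    (A : Fin (n + 1) → Matrix I I ℂ) :
    (List.ofFn A).reverse.prod.trace =
      ∑ x : Fin (n + 1) → I, ∏ k, A k (x (finRotate (n + 1) k)) (x k) := by
  simp only [Matrix.trace, Matrix.diag_apply, ofFn_reverse_prod_apply]
  rw [Finset.sum_comm, ← (Fin.snocEquiv fun _ : Fin (n + 2) => I).sum_comp,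
    Fintype.sum_prod_type, Finset.sum_comm]
  refine Finset.sum_congr rfl fun x _ => ?_
  have h0 : ∀ w : I, (Fin.snoc (α := fun _ => I) x w) 0 = x 0 := fun w =>
    Fin.snoc_castSucc (α := fun _ => I) w x 0
  simp only [Fin.snocEquiv_apply, h0, Fin.snoc_last, Fin.snoc_castSucc]
  rw [Finset.sum_eq_single (x 0), Finset.sum_eq_single (x 0)]
  · simp only [and_self, if_true]
    refine Finset.prod_congr rfl fun k _ => ?_
    congr 1
    induction k using Fin.lastCases with
    | last => rw [finRotate_last, Fin.succ_last, Fin.snoc_last]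
    | cast k =>
      rw [Fin.succ_castSucc, Fin.snoc_castSucc]
      congr 1
      rw [Fin.ext_iff, coe_finRotate_of_ne_last (Fin.castSucc_lt_last k).ne]
      simp
  · intro y _ hy
    simp [hy.symm]
  · simp
  · intro w _ hw
    refine Finset.sum_eq_zero fun y _ => if_neg ?_
    rintro ⟨rfl, h⟩
    exact hw h
  · simp

/-- The letter of a colour: `true` for `AB` and `false` for `AC`. -/
def letterOf (b : Bool) : Letter := if b then .AB else .AC

variable {a n d : ℕ}

/-- The tensor index with matrix index `x`, whose other indices are `w`. -/
def mkIdx (b : Bool) (x : Fin a × Fin n) (w : Fin n × Fin d) : Idx a n n d :=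
  if b then (x.1, x.2, w.1, w.2) else (x.1, w.1, x.2, w.2)

theorem W_apply (X : Idx a n n d → ℂ) (b : Bool) (x y : Fin a × Fin n) :
    W X (letterOf b) x y =
      ∑ w : Fin n × Fin d, X (mkIdx b x w) * conj (X (mkIdx b y w)) := by
  rw [Fintype.sum_prod_type]
  cases b <;> rfl

theorem trace_wordProd {p : ℕ} (X : Idx a n n d → ℂ) (c : Fin (p + 1) → Bool) :
    (wordProd X fun k => letterOf (c k)).trace =
      ∑ x : Fin (p + 1) → Fin a × Fin n, ∑ w : Fin (p + 1) → Fin n × Fin d,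
        ∏ k, (X (mkIdx (c k) (x (finRotate (p + 1) k)) (w k)) *
          conj (X (mkIdx (c k) (x k) (w k)))) := by
  rw [wordProd, trace_ofFn_reverse_prod]
  refine Finset.sum_congr rfl fun x _ => ?_
  simp only [W_apply]
  rw [Finset.prod_univ_sum, Fintype.piFinset_univ]

/-! ### Counting index assignments -/

/-- Functions invariant under a permutation are functions on its cycles. -/
theorem card_invariant {V : Type*} [Fintype V] [DecidableEq V] (τ : Perm V) (k : ℕ) :
    (Finset.univ.filter fun v : V → Fin k => ∀ x, v (τ x) = v x).card = k ^ numCycles τ := by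
  classical
  have e : {v : V → Fin k // ∀ x, v (τ x) = v x} ≃ (Quotient (SameCycle.setoid τ) → Fin k) :=
    { toFun := fun v q => q.lift v.1 fun x y h => by
        have := sameCycle_setoid_le (a := τ) (r := Setoid.ker v.1) (fun x => (v.2 x).symm)
        exact this h
      invFun := fun v => ⟨fun x => v (Quotient.mk _ x), fun x => congrArg v (Quotient.sound
        (SameCycle.symm ⟨1, by simp⟩))⟩
      left_inv := fun v => rfl
      right_inv := fun v => by
        funext q
        induction q using Quotient.inductionOn with | _ x => rfl }
  have : Fintype (Quotient (SameCycle.setoid τ)) := Fintype.ofFinite _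
  rw [← Fintype.card_subtype, Fintype.card_congr e, Fintype.card_fun, Fintype.card_fin, numCycles,
    numClasses, Nat.card_eq_fintype_card]

theorem card_comp_eq {V : Type*} [Fintype V] [DecidableEq V] (σ τ : Perm V) (k : ℕ) :
    (Finset.univ.filter fun v : V → Fin k => ∀ x, v (σ x) = v (τ x)).card =
      k ^ numCycles (σ * τ⁻¹) := by
  rw [← card_invariant]
  congr 1
  ext v
  simp only [Finset.mem_filter, Finset.mem_univ, true_and]
  constructor
  · intro h x
    rw [Perm.mul_apply, h]
    simp
  · intro h x
    have := h (τ x)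
    simpa using this

variable {p : ℕ}

/-- The permutation of the slots `(k, B)`, `(k, C)` that follows the contractions in the word with
colours `c`. -/
def slotPerm (c : Fin p → Bool) (γ : Perm (Fin p)) : Perm (Fin p × Bool) where
  -- The slot `(k, c k)` carries the matrix index, which passes to the next letter. The slot `(k, !c
  -- k)` carries the index summed by the partial trace, which stays at `k`.
  toFun x := if x.2 = c x.1 then (γ x.1, c (γ x.1)) else x
  invFun x := if x.2 = c x.1 then (γ⁻¹ x.1, c (γ⁻¹ x.1)) else x
  left_inv x := by
    by_cases h : x.2 = c x.1
    · dsimp only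
      rw [if_pos h]
      simp [Prod.ext_iff, h]
    · simp [h]
  right_inv x := by
    by_cases h : x.2 = c x.1
    · dsimp only
      rw [if_pos h]
      simp [Prod.ext_iff, h]
    · simp [h]

theorem slotPerm_apply (c : Fin p → Bool) (γ : Perm (Fin p)) (x : Fin p × Bool) :
    slotPerm c γ x = if x.2 = c x.1 then (γ x.1, c (γ x.1)) else x := rfl

/-- Both slots follow `α`. -/
def doublePerm (α : Perm (Fin p)) : Perm (Fin p × Bool) := Equiv.prodCongr α (Equiv.refl Bool)

theorem doublePerm_apply (α : Perm (Fin p)) (x : Fin p × Bool) :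
    doublePerm α x = (α x.1, x.2) := rfl

/-- Index assignments, reorganised by tensor factor. -/
def indexEquiv (c : Fin p → Bool) (a n d : ℕ) :
    (Fin p → Fin a × Fin n) × (Fin p → Fin n × Fin d) ≃
      (Fin p → Fin a) × (Fin p × Bool → Fin n) × (Fin p → Fin d) where
  toFun z := (fun k => (z.1 k).1, fun x => if x.2 = c x.1 then (z.1 x.1).2 else (z.2 x.1).1,
    fun k => (z.2 k).2)
  invFun z := (fun k => (z.1 k, z.2.1 (k, c k)), fun k => (z.2.1 (k, !c k), z.2.2 k))
  left_inv z := by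
    ext k <;> simp
  right_inv z := by
    refine Prod.ext rfl (Prod.ext ?_ rfl)
    funext ⟨k, s⟩
    by_cases h : s = c k
    · simp [h]
    · have : s = !c k := by cases s <;> cases hc : c k <;> simp_all
      simp [this]

theorem mkIdx_indexEquiv_symm (c : Fin p → Bool) (u : Fin p → Fin a) (v : Fin p × Bool → Fin n)
    (w : Fin p → Fin d) (k : Fin p) :
    mkIdx (c k) (((indexEquiv c a n d).symm (u, v, w)).1 k)
      (((indexEquiv c a n d).symm (u, v, w)).2 k) = (u k, v (k, true), v (k, false), w k) := by
  simp only [indexEquiv, Equiv.coe_fn_symm_mk, mkIdx]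
  cases c k <;> rfl

theorem mkIdx_indexEquiv_symm_shift (c : Fin p → Bool) (γ : Perm (Fin p)) (u : Fin p → Fin a)
    (v : Fin p × Bool → Fin n) (w : Fin p → Fin d) (k : Fin p) :
    mkIdx (c k) (((indexEquiv c a n d).symm (u, v, w)).1 (γ k))
      (((indexEquiv c a n d).symm (u, v, w)).2 k) =
      (u (γ k), v (slotPerm c γ (k, true)), v (slotPerm c γ (k, false)), w k) := by
  simp only [indexEquiv, Equiv.coe_fn_symm_mk, mkIdx, slotPerm_apply]
  cases c k <;> simp

/-- The constraints decouple by tensor factor, and each count is a power with one free value per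
cycle. The factors `B` and `C` have equal dimension, so their slots are treated together. -/
theorem card_index_assignments (c : Fin p → Bool) (γ α : Perm (Fin p)) (a n d : ℕ) :
    (Finset.univ.filter fun z : (Fin p → Fin a × Fin n) × (Fin p → Fin n × Fin d) =>
      ∀ k, mkIdx (c k) (z.1 (γ k)) (z.2 k) = mkIdx (c (α k)) (z.1 (α k)) (z.2 (α k))).card =
      a ^ numCycles (γ * α⁻¹) * (n ^ numCycles (slotPerm c γ * (doublePerm α)⁻¹) *
        d ^ numCycles α) := by
  have h1 := card_comp_eq γ α a
  have h2 := card_comp_eq (slotPerm c γ) (doublePerm α) n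
  have h3 := card_comp_eq 1 α d
  rw [one_mul, numCycles_inv] at h3
  rw [← h1, ← h2, ← h3, ← Finset.card_product, ← Finset.card_product]
  refine Finset.card_equiv (indexEquiv c a n d) fun z => ?_
  obtain ⟨⟨u, v, w⟩, rfl⟩ := (indexEquiv c a n d).symm.surjective z
  simp only [Finset.mem_filter, Finset.mem_univ, true_and, Finset.mem_product,
    Equiv.apply_symm_apply, mkIdx_indexEquiv_symm, mkIdx_indexEquiv_symm_shift, Prod.mk.injEq,
    Prod.forall, Bool.forall_bool, doublePerm_apply]
  constructor
  · exact fun h => ⟨fun k => (h k).1, fun k => ⟨(h k).2.2.1, (h k).2.1⟩, fun k => (h k).2.2.2⟩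
  · exact fun h k => ⟨h.1 k, (h.2.1 k).2, (h.2.1 k).1, h.2.2 k⟩

/-! ### The exponents -/

/-- Every cycle of `α` has a single colour. -/
def IsMonoPerm (c : Fin p → Bool) (α : Perm (Fin p)) : Prop := ∀ x y, SameCycle α x y → c x = c y

theorem le_numCycles {V S : Type*} [Fintype V] [Finite S] {τ : Perm V} (φ : V → S)
    (hφ : Function.Surjective φ) (h : ∀ x, φ (τ x) = φ x) : Nat.card S ≤ numCycles τ := by
  have hle : SameCycle.setoid τ ≤ Setoid.ker φ := sameCycle_setoid_le fun x => (h x).symm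
  refine Nat.card_le_card_of_surjective
    (Quotient.lift φ fun x y hxy => (hle hxy : Setoid.ker φ x y)) ?_
  intro s
  obtain ⟨x, rfl⟩ := hφ s
  exact ⟨Quotient.mk _ x, rfl⟩

theorem le_numCycles_slotPerm (c : Fin (p + 1) → Bool) (γ : Perm (Fin (p + 1))) :
    p + 2 ≤ numCycles (slotPerm c γ) := by
  have := le_numCycles (τ := slotPerm c γ)
    (fun x => if x.2 = c x.1 then (none : Option (Fin (p + 1))) else some x.1) ?_ ?_
  · rw [Nat.card_eq_fintype_card, Fintype.card_option, Fintype.card_fin] at this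
    omega
  · rintro (_ | k)
    · exact ⟨(0, c 0), by simp⟩
    · exact ⟨(k, !c k), by simp⟩
  · intro x
    rw [slotPerm_apply]
    by_cases h : x.2 = c x.1
    · simp [h]
    · simp [h]

theorem le_numCycles_doublePerm (α : Perm (Fin p)) :
    2 * numCycles α ≤ numCycles (doublePerm α) := by
  have := le_numCycles (τ := doublePerm α)
    (fun x => (Quotient.mk (SameCycle.setoid α) x.1, x.2)) ?_ ?_
  · rw [Nat.card_prod] at this
    simpa [numCycles, numClasses, mul_comm] using this
  · rintro ⟨q, s⟩
    induction q using Quotient.inductionOn with | _ x => exact ⟨(x, s), rfl⟩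
  · intro x
    exact Prod.ext (Quotient.sound (SameCycle.symm ⟨1, by simp [doublePerm_apply]⟩)) rfl

theorem sameCycle_doublePerm {α : Perm (Fin p)} {x y : Fin p} (h : SameCycle α x y) (s : Bool) :
    SameCycle (doublePerm α) (x, s) (y, s) := by
  let r : Setoid (Fin p) := (SameCycle.setoid (doublePerm α)).comap fun x => (x, s)
  exact sameCycle_setoid_le (r := r) (fun x => (⟨1, by simp [doublePerm_apply]⟩ :
    SameCycle (doublePerm α) (x, s) (α x, s))) h

theorem sameCycle_slotPerm (c : Fin p → Bool) (x y : Fin p) :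
    SameCycle (slotPerm c (finRotate p)) (x, c x) (y, c y) := by
  let r : Setoid (Fin p) := (SameCycle.setoid (slotPerm c (finRotate p))).comap fun x => (x, c x)
  exact sameCycle_setoid_le (r := r) (fun x => (⟨1, by simp [slotPerm_apply]⟩ :
    SameCycle (slotPerm c (finRotate p)) (x, c x) (_, _))) (sameCycle_finRotate x y)

/-- In the genus inequality on `2 * (p + 1)` slots, `slotPerm` has at least `p + 2` cycles,
`doublePerm α` at least `2 * numCycles α`, and there are at most `numCycles α` joint classes. This
leaves at most `p` cycles for the product. -/
theorem numCycles_slotPerm_lt {c : Fin (p + 1) → Bool} {α : Perm (Fin (p + 1))}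
    (h : ¬ IsMonoPerm c α) :
    numCycles (slotPerm c (finRotate (p + 1)) * (doublePerm α)⁻¹) < p + 2 := by
  have h1 := numCycles_add_add_le (slotPerm c (finRotate (p + 1))) (doublePerm α)⁻¹
  have h2 := le_numCycles_slotPerm c (finRotate (p + 1))
  have h3 := le_numCycles_doublePerm α
  rw [numCycles_inv] at h1
  have e : SameCycle.setoid (doublePerm α)⁻¹ = SameCycle.setoid (doublePerm α) := by
    ext x y
    exact sameCycle_inv
  rw [e] at h1
  set t := SameCycle.setoid (slotPerm c (finRotate (p + 1))) ⊔ SameCycle.setoid (doublePerm α)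
  have hs : ∀ x y, t (x, c x) (y, c y) := fun x y =>
    (le_sup_left : _ ≤ t) (sameCycle_slotPerm c x y)
  have hd : ∀ x y s, SameCycle α x y → t (x, s) (y, s) := fun x y s hxy =>
    (le_sup_right : _ ≤ t) (sameCycle_doublePerm hxy s)
  obtain ⟨x₀, y₀, hxy₀, hne₀⟩ : ∃ x y, SameCycle α x y ∧ c x ≠ c y := by
    unfold IsMonoPerm at h
    push Not at h
    exact h
  have hmix : ∀ x y, SameCycle α x y → c x ≠ c y → ∀ z, t (x, !c x) (z, c z) := by
    intro x y hxy hne z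
    have h4 : (!c x) = c y := by cases hx : c x <;> cases hy : c y <;> simp_all
    rw [h4]
    exact t.trans (hd x y (c y) hxy) (hs y z)
  -- The slots `(x, !c x)` represent every joint class: a bicoloured cycle links one of them to the
  -- common class of all slots `(k, c k)`. Their class depends only on the cycle of `x`.
  have h4 : numClasses t ≤ numCycles α := by
    refine Nat.card_le_card_of_surjective (Quotient.lift
      (s := SameCycle.setoid α) (fun x => Quotient.mk t (x, !c x)) fun x y hxy => ?_) ?_
    · have hxy' : SameCycle α x y := hxy
      refine Quotient.sound ?_
      by_cases hc : c x = c y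
      · rw [hc]
        exact hd x y _ hxy'
      · exact t.trans (hmix x y hxy' hc x) (t.symm (hmix y x hxy'.symm (Ne.symm hc) x))
    · intro q
      induction q using Quotient.inductionOn with | _ z => ?_
      obtain ⟨k, s⟩ := z
      by_cases hks : s = c k
      · refine ⟨Quotient.mk _ x₀, Quotient.sound ?_⟩
        rw [hks]
        exact hmix x₀ y₀ hxy₀ hne₀ k
      · refine ⟨Quotient.mk _ k, ?_⟩
        have : s = !c k := by cases s <;> cases hc : c k <;> simp_all
        rw [this]
        rfl
  have h5 : Fintype.card (Fin (p + 1) × Bool) = 2 * (p + 1) := by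
    simp [mul_comm]
  omega

/-- When `α` preserves colours, the slots `(k, c k)` and `(k, !c k)` do not interact: the former
give `γ * α⁻¹`, the latter `α⁻¹`. The exponents are compared by counting invariant two-valued
functions. -/
theorem numCycles_slotPerm_eq {c : Fin p → Bool} {γ α : Perm (Fin p)} (h : IsMonoPerm c α) :
    numCycles (slotPerm c γ * (doublePerm α)⁻¹) = numCycles (γ * α⁻¹) + numCycles α := by
  have h1 := card_comp_eq (slotPerm c γ) (doublePerm α) 2
  have h2 := card_comp_eq γ α 2
  have h3 := card_comp_eq 1 α 2
  rw [one_mul, numCycles_inv] at h3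
  apply Nat.pow_right_injective (le_refl 2)
  change 2 ^ _ = 2 ^ _
  rw [pow_add, ← h1, ← h2, ← h3, ← Finset.card_product]
  have hc : ∀ k, c (α k) = c k := fun k => (h k (α k) ⟨1, by simp⟩).symm
  let e : (Fin p × Bool → Fin 2) ≃ (Fin p → Fin 2) × (Fin p → Fin 2) :=
    { toFun := fun v => (fun k => v (k, c k), fun k => v (k, !c k))
      invFun := fun z x => if x.2 = c x.1 then z.1 x.1 else z.2 x.1
      left_inv := fun v => by
        funext ⟨k, s⟩
        by_cases hs : s = c k
        · simp [hs]
        · have : s = !c k := by cases s <;> cases hc : c k <;> simp_all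
          simp [this]
      right_inv := fun z => by
        ext k <;> simp }
  refine Finset.card_equiv e fun v => ?_
  simp only [Finset.mem_filter, Finset.mem_univ, true_and, Finset.mem_product, Prod.forall]
  have key : (∀ k s, v (slotPerm c γ (k, s)) = v (doublePerm α (k, s))) ↔
      ∀ k, v (slotPerm c γ (k, c k)) = v (doublePerm α (k, c k)) ∧
        v (slotPerm c γ (k, !c k)) = v (doublePerm α (k, !c k)) := by
    refine forall_congr' fun k => ?_
    cases c k <;> simp [Bool.forall_bool, and_comm]
  rw [key, forall_and]
  refine and_congr (forall_congr' fun k => ?_) (forall_congr' fun k => ?_)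
  · simp [slotPerm_apply, doublePerm_apply, e, hc]
  · simp [slotPerm_apply, doublePerm_apply, e, hc]

/-! ### The exact moments -/

theorem integrable_trace {Ω : Type*} [MeasurableSpace Ω] {P : Measure Ω} [IsProbabilityMeasure P]
    {X : Ω → Idx a n n d → ℂ} (hX : IsGaussianTensor X P) (c : Fin (p + 1) → Bool) :
    Integrable (fun ω => (wordProd (X ω) fun k => letterOf (c k)).trace) P := by
  simp only [trace_wordProd]
  exact integrable_finsetSum _ fun x _ => integrable_finsetSum _ fun w _ => integrable_wick hX _ _

theorem integral_trace {Ω : Type*} [MeasurableSpace Ω] {P : Measure Ω} [IsProbabilityMeasure P]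
    {X : Ω → Idx a n n d → ℂ} (hX : IsGaussianTensor X P) (c : Fin (p + 1) → Bool) :
    ∫ ω, (wordProd (X ω) fun k => letterOf (c k)).trace ∂P =
      ∑ α : Perm (Fin (p + 1)), ((a ^ numCycles (finRotate (p + 1) * α⁻¹) *
        (n ^ numCycles (slotPerm c (finRotate (p + 1)) * (doublePerm α)⁻¹) *
          d ^ numCycles α) : ℕ) : ℂ) := by
  simp only [trace_wordProd]
  rw [integral_finsetSum _ fun x _ => integrable_finsetSum _ fun w _ => integrable_wick hX _ _]
  simp only [integral_finsetSum _ fun w _ => integrable_wick hX _ _, integral_wick hX]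
  rw [← Fintype.sum_prod_type']
  simp only [← card_index_assignments]
  norm_cast
  simp only [Finset.card_filter]
  rw [Finset.sum_comm]
  refine Finset.sum_congr rfl fun α _ => Finset.sum_congr rfl fun z _ => ?_
  congr

end WishartMarginals

/-! ### Asymptotics -/

namespace WishartMarginals

open Equiv Equiv.Perm

/-- A zero `NA N` would make the ratio `0` by the division convention, which the limit `1` excludes
eventually. -/
theorem eventually_dims {NA ND : ℕ → ℕ}
    (h : Tendsto (fun N => (ND N : ℝ) / (NA N : ℝ)) atTop (𝓝 1)) :
    ∀ᶠ N : ℕ in atTop, (1 : ℝ) ≤ N ∧ (1 : ℝ) ≤ NA N ∧ (ND N : ℝ) ≤ 2 * NA N := by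
  filter_upwards [eventually_ge_atTop 1, h.eventually_const_lt (show (1 / 2 : ℝ) < 1 by norm_num),
    h.eventually_lt_const (show (1 : ℝ) < 2 by norm_num)] with N h1 h2 h3
  have h4 : NA N ≠ 0 := by
    intro h0
    rw [h0, Nat.cast_zero, div_zero] at h2
    norm_num at h2
  have h5 : (1 : ℝ) ≤ NA N := by exact_mod_cast Nat.one_le_iff_ne_zero.2 h4
  refine ⟨by exact_mod_cast h1, h5, ?_⟩
  rw [div_lt_iff₀ (by linarith)] at h3
  exact h3.le

/-- The missing power of `N` alone gives the decay; the powers of `N_A` and `N_D` balance through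
`N_D ≤ 2 N_A`, without any growth of `N_A`. -/
theorem tendsto_monomial_zero {NA ND : ℕ → ℕ}
    (h : Tendsto (fun N => (ND N : ℝ) / (NA N : ℝ)) atTop (𝓝 1)) {q A L D : ℕ}
    (hAD : A + D ≤ q) (hL : L < q) :
    Tendsto (fun N => (((NA N : ℝ) * (N : ℝ)) ^ q)⁻¹ *
      ((NA N : ℝ) ^ A * ((N : ℝ) ^ L * (ND N : ℝ) ^ D))) atTop (𝓝 0) := by
  have hlim : Tendsto (fun N : ℕ => (2 : ℝ) ^ D * (N : ℝ)⁻¹) atTop (𝓝 0) := by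
    simpa using (tendsto_inv_atTop_nhds_zero_nat (𝕜 := ℝ)).const_mul ((2 : ℝ) ^ D)
  refine squeeze_zero' (Eventually.of_forall fun N => by positivity) ?_ hlim
  filter_upwards [eventually_dims h] with N ⟨h1, h2, h3⟩
  have e1 : (ND N : ℝ) ^ D ≤ 2 ^ D * (NA N : ℝ) ^ D := by
    rw [← mul_pow]
    exact pow_le_pow_left₀ (by positivity) h3 D
  have e2 : (NA N : ℝ) ^ A * (NA N : ℝ) ^ D ≤ (NA N : ℝ) ^ q := by
    rw [← pow_add]
    exact pow_le_pow_right₀ h2 hAD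
  have e3 : (N : ℝ) ^ L * N ≤ (N : ℝ) ^ q := by
    rw [← pow_succ]
    exact pow_le_pow_right₀ h1 hL
  have hN : (0 : ℝ) < N := by linarith
  have hNA : (0 : ℝ) < NA N := by linarith
  rw [inv_mul_le_iff₀ (by positivity), ← div_eq_mul_inv, ← mul_div_assoc, le_div_iff₀ hN, mul_pow]
  calc (NA N : ℝ) ^ A * ((N : ℝ) ^ L * (ND N : ℝ) ^ D) * N
      = (NA N : ℝ) ^ A * (ND N : ℝ) ^ D * ((N : ℝ) ^ L * N) := by ring
    _ ≤ (NA N : ℝ) ^ A * (2 ^ D * (NA N : ℝ) ^ D) * (N : ℝ) ^ q := by gcongr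
    _ = 2 ^ D * ((NA N : ℝ) ^ A * (NA N : ℝ) ^ D) * (N : ℝ) ^ q := by ring
    _ ≤ 2 ^ D * (NA N : ℝ) ^ q * (N : ℝ) ^ q := by gcongr
    _ = (NA N : ℝ) ^ q * (N : ℝ) ^ q * 2 ^ D := by ring

theorem tendsto_monomial_one {NA ND : ℕ → ℕ}
    (h : Tendsto (fun N => (ND N : ℝ) / (NA N : ℝ)) atTop (𝓝 1)) {q A D : ℕ}
    (hAD : A + D = q) :
    Tendsto (fun N => (((NA N : ℝ) * (N : ℝ)) ^ q)⁻¹ *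
      ((NA N : ℝ) ^ A * ((N : ℝ) ^ q * (ND N : ℝ) ^ D))) atTop (𝓝 1) := by
  have hlim := h.pow D
  rw [one_pow] at hlim
  refine hlim.congr' ?_
  filter_upwards [eventually_dims h] with N ⟨h1, h2, h3⟩
  have hN : (N : ℝ) ≠ 0 := by linarith
  have hNA : (NA N : ℝ) ≠ 0 := by linarith
  rw [← hAD, div_pow, mul_pow, pow_add (NA N : ℝ)]
  field_simp

variable {p : ℕ}

open Classical in
theorem card_geodesic_isMonoPerm (c : Fin p → Bool) :
    (Finset.univ.filter fun α : Perm (Fin p) =>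
      Geodesic α (finRotate p) ∧ IsMonoPerm c α).card =
      (Finset.univ.filter fun α : NC p => IsMono c α).card := by
  symm
  have hm : ∀ σ : NC p, IsMonoPerm c (toPerm σ) ↔ IsMono c σ := fun σ => by
    simp only [IsMonoPerm, IsMono, sameCycle_toPerm]
  refine Finset.card_bij (fun σ _ => toPerm σ) ?_ (fun _ _ _ _ h => toPerm_injective h) ?_
  · intro σ hσ
    simp only [Finset.mem_filter, Finset.mem_univ, true_and] at hσ ⊢
    exact ⟨geodesic_finRotate_iff.2 ⟨σ, rfl⟩, (hm σ).2 hσ⟩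
  · intro α hα
    simp only [Finset.mem_filter, Finset.mem_univ, true_and] at hα
    obtain ⟨σ, rfl⟩ := geodesic_finRotate_iff.1 hα.1
    exact ⟨σ, by simpa using (hm σ).1 hα.2, rfl⟩

open Classical in
theorem tendsto_permutation_term {NA ND : ℕ → ℕ}
    (h : Tendsto (fun N => (ND N : ℝ) / (NA N : ℝ)) atTop (𝓝 1)) (c : Fin (p + 1) → Bool)
    (α : Perm (Fin (p + 1))) :
    Tendsto (fun N => (((NA N : ℝ) * (N : ℝ)) ^ (p + 2))⁻¹ *
      ((NA N : ℝ) ^ numCycles (finRotate (p + 1) * α⁻¹) *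
        ((N : ℝ) ^ numCycles (slotPerm c (finRotate (p + 1)) * (doublePerm α)⁻¹) *
          (ND N : ℝ) ^ numCycles α))) atTop
      (𝓝 (if Geodesic α (finRotate (p + 1)) ∧ IsMonoPerm c α then 1 else 0)) := by
  -- There are `p + 1` letters and the long cycle is a single cycle, so the exponents of `N_A` and
  -- `N_D` add up to at most `p + 2`.
  have h1 := numCycles_add_le (finRotate (p + 1) * α⁻¹) α
  rw [inv_mul_cancel_right, numCycles_finRotate, Fintype.card_fin] at h1
  have hgeo : Geodesic α (finRotate (p + 1)) ↔
      numCycles (finRotate (p + 1) * α⁻¹) + numCycles α = p + 2 := by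
    rw [Geodesic, numCycles_mul_comm α⁻¹, numCycles_finRotate, Fintype.card_fin]
    omega
  by_cases hm : IsMonoPerm c α
  · have hL := numCycles_slotPerm_eq (γ := finRotate (p + 1)) hm
    by_cases hg : Geodesic α (finRotate (p + 1))
    · rw [if_pos ⟨hg, hm⟩, hL, hgeo.1 hg]
      exact tendsto_monomial_one h (hgeo.1 hg)
    · rw [if_neg fun h' => hg h'.1]
      rw [hgeo] at hg
      exact tendsto_monomial_zero h (by omega) (by omega)
  · rw [if_neg fun h' => hm h'.2]
    exact tendsto_monomial_zero h (by omega) (numCycles_slotPerm_lt hm)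

theorem card_NC_zero : Fintype.card (NC 0) = 1 := by
  rw [Fintype.card_eq_one_iff]
  exact ⟨NC.ofSetoid ⊥ fun a => a.elim0, fun σ => nc_ext fun x => x.elim0⟩

open Classical in
/-- The limit of the normalised moment of a word is a number of non-crossing partitions. -/
theorem tendsto_moment_word {NA ND : ℕ → ℕ}
    (h : Tendsto (fun N => (ND N : ℝ) / (NA N : ℝ)) atTop (𝓝 1))
    {Ω : ℕ → Type*} [∀ N, MeasurableSpace (Ω N)] {P : ∀ N, Measure (Ω N)}
    [∀ N, IsProbabilityMeasure (P N)] {X : ∀ N, Ω N → Idx (NA N) N N (ND N) → ℂ}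
    (hX : ∀ N, IsGaussianTensor (X N) (P N)) (c : Fin p → Bool) :
    (∀ N, Integrable (fun ω => (wordProd (X N ω) fun k => letterOf (c k)).trace) (P N)) ∧
    Tendsto (fun N => (((NA N : ℂ) * (N : ℂ)) ^ (p + 1))⁻¹ *
      ∫ ω, (wordProd (X N ω) fun k => letterOf (c k)).trace ∂(P N)) atTop
      (𝓝 ((Finset.univ.filter fun α : NC p => IsMono c α).card : ℂ)) := by
  rcases p with _ | p
  -- The empty word is treated apart, as the closed-path formula needs at least one vertex.
  · have htr : ∀ N ω, (wordProd (X N ω) fun k => letterOf (c k)).trace = (NA N : ℂ) * N := by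
      intro N ω
      simp [wordProd, Matrix.trace_one]
    have hcard : (Finset.univ.filter fun α : NC 0 => IsMono c α).card = 1 := by
      rw [Finset.filter_true_of_mem fun _ _ x => x.elim0, Finset.card_univ, card_NC_zero]
    simp only [htr, hcard, integral_const, probReal_univ, one_smul]
    refine ⟨fun N => integrable_const _, ?_⟩
    rw [Nat.cast_one]
    refine tendsto_const_nhds.congr' ?_
    filter_upwards [eventually_dims h] with N ⟨h1, h2, _⟩
    have hN : (N : ℂ) ≠ 0 := by
      have : (N : ℝ) ≠ 0 := by linarith
      exact_mod_cast this
    have hNA : (NA N : ℂ) ≠ 0 := by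
      have : (NA N : ℝ) ≠ 0 := by linarith
      exact_mod_cast this
    rw [zero_add, pow_one, inv_mul_cancel₀ (mul_ne_zero hNA hN)]
  · refine ⟨fun N => integrable_trace (hX N) c, ?_⟩
    have h1 := tendsto_finsetSum (Finset.univ : Finset (Perm (Fin (p + 1))))
      fun α _ => tendsto_permutation_term h c α
    rw [← Finset.sum_filter, Finset.sum_const, nsmul_eq_mul, mul_one,
      card_geodesic_isMonoPerm] at h1
    have h2 := (Complex.continuous_ofReal.tendsto _).comp h1
    rw [Complex.ofReal_natCast] at h2
    refine h2.congr fun N => ?_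
    rw [integral_trace (hX N) c, Finset.mul_sum, Function.comp_apply]
    push_cast
    rfl

/-! ### Words from exponent vectors -/

/-- The coloured points of the word with exponents `r`, `s`, in increasing order. -/
def pointList {m : ℕ} (r s : Fin m → ℕ) : List (Fin m × Bool) :=
  (List.finRange m).flatMap fun i =>
    -- The `AC` points of each index come first because the word is read from right to left.
    List.replicate (s i) (i, false) ++ List.replicate (r i) (i, true)

theorem card_get_eq {α : Type*} [DecidableEq α] [BEq α] [LawfulBEq α] (l : List α) (q : α) :
    (Finset.univ.filter fun k : Fin l.length => l.get k = q).card = l.count q := by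
  induction l with
  | nil => simp
  | cons a l ih =>
    rw [Finset.card_filter] at ih ⊢
    rw [List.count_cons, ← ih]
    change ∑ k : Fin (l.length + 1), _ = _
    rw [Fin.sum_univ_succ, add_comm]
    congr 1
    by_cases h : a = q <;> simp [h]

theorem count_pointList {m : ℕ} (r s : Fin m → ℕ) (i : Fin m) (b : Bool) :
    (pointList r s).count (i, b) = if b then r i else s i := by
  rw [pointList, List.count_flatMap, ← List.ofFn_eq_map, List.sum_ofFn,
    Finset.sum_eq_single i]
  · cases b <;> simp [List.count_append, List.count_replicate]
  · intro j _ hj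
    simp [List.count_append, List.count_replicate, hj]
  · simp

theorem isColoring_pointList {m : ℕ} (r s : Fin m → ℕ) :
    IsColoring (fun k => ((pointList r s).get k).1) (fun k => ((pointList r s).get k).2) := by
  have h : (pointList r s).Pairwise fun x y => x.1 < y.1 ∨ (x.1 = y.1 ∧ (x.2 = true → y.2 = true)) := by
    rw [pointList, List.pairwise_flatMap]
    constructor
    · intro i _
      rw [List.pairwise_append, List.pairwise_replicate, List.pairwise_replicate]
      refine ⟨Or.inr (by simp), Or.inr (by simp), fun x hx y hy => ?_⟩
      rw [List.eq_of_mem_replicate hx, List.eq_of_mem_replicate hy]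
      simp
    · refine (List.pairwise_lt_finRange m).imp fun {i j} hij x hx y hy => Or.inl ?_
      have aux : ∀ {k : Fin m} {z}, z ∈ List.replicate (s k) (k, false) ++
          List.replicate (r k) (k, true) → z.1 = k := by
        intro k z hz
        rcases List.mem_append.1 hz with h | h <;> rw [List.eq_of_mem_replicate h]
      rwa [aux hx, aux hy]
  rw [List.pairwise_iff_get] at h
  intro x y hxy
  rcases hxy.lt_or_eq with hlt | rfl
  · exact h x y hlt
  · exact Or.inr ⟨rfl, id⟩

theorem powProd_eq_wordProd {m a n d : ℕ} (r s : Fin m → ℕ) (X : Idx a n n d → ℂ) :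
    powProd X r s = wordProd X fun k => letterOf ((pointList r s).get k).2 := by
  have h1 : (List.ofFn fun k => W X (letterOf ((pointList r s).get k).2)) =
      (pointList r s).map fun x => W X (letterOf x.2) := by
    conv_rhs => rw [← List.ofFn_get (pointList r s), List.map_ofFn]
    rfl
  rw [powProd, wordProd, h1, pointList, List.ofFn_eq_map]
  induction List.finRange m with
  | nil => rfl
  | cons i l ih =>
    rw [List.map_cons, List.flatMap_cons, List.map_append, List.reverse_cons, List.reverse_append,
      List.prod_append, List.prod_append, ← ih]
    congr 1
    simp [letterOf, W]

theorem length_pointList {m : ℕ} (r s : Fin m → ℕ) :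
    (pointList r s).length = ∑ i, (r i + s i) := by
  rw [pointList, List.length_flatMap, ← List.ofFn_eq_map, List.sum_ofFn]
  refine Finset.sum_congr rfl fun i _ => ?_
  simp [add_comm]

/-- Each letter is its own factor, with exponents `(1, 0)` or `(0, 1)`, so `m = p`. -/
theorem wordProd_eq_powProd {a n d p : ℕ} (X : Idx a n n d → ℂ) (f : Fin p → Letter) :
    wordProd X f = powProd X (fun i => match f i with | .AB => 1 | .AC => 0)
      (fun i => match f i with | .AB => 0 | .AC => 1) := by
  rw [wordProd, powProd]
  congr 3
  funext i
  cases f i <;> simp [W]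

end WishartMarginals

end

/-! ### The main theorem -/

open WishartMarginals in
theorem mainTheorem9 :
    -- every word in the two marginals is of the form described by two integer vectors
    (∀ (p : ℕ) (f : Fin p → Letter), ∃ (m : ℕ) (r s : Fin m → ℕ), p = ∑ i, (r i + s i) ∧
      ∀ (a n d : ℕ) (X : Idx a n n d → ℂ), wordProd X f = powProd X r s) ∧
    -- the Möbius function of the non-crossing partition lattice
    (∀ (m : ℕ) (σ π : NC m), σ ≤ π →
      mob σ π = signedCatalanProd ((toPerm σ)⁻¹ * toPerm π)) ∧
    -- the asymptotic mixed moments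
    (∀ (NA ND : ℕ → ℕ), Tendsto (fun N => (ND N : ℝ) / (NA N : ℝ)) atTop (𝓝 1) →
      ∀ (Ω : ℕ → Type*) [∀ N, MeasurableSpace (Ω N)] (P : ∀ N, Measure (Ω N))
        [∀ N, IsProbabilityMeasure (P N)] (X : ∀ N, Ω N → Idx (NA N) N N (ND N) → ℂ),
        (∀ N, IsGaussianTensor (X N) (P N)) →
        ∀ (m : ℕ) (r s : Fin m → ℕ),
          (∀ N, Integrable (fun ω => (powProd (X N ω) r s).trace) (P N)) ∧
          Tendsto
            (fun N => (((NA N : ℂ) * (N : ℂ)) ^ (∑ i, (r i + s i) + 1))⁻¹ *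
              ∫ ω, (powProd (X N ω) r s).trace ∂(P N))
            atTop
            (𝓝 (((∑ σ : NC m, ∑ π : NC m with σ ≤ π,
              (catProd σ r : ℤ) * (catProd (kreweras π) s : ℤ) * mob σ π : ℤ)) : ℂ))) := by
  refine ⟨fun p f => ⟨p, _, _, ?_, fun a n d X => wordProd_eq_powProd X f⟩,
    fun m σ π h => mob_eq_signedCatalanProd h, ?_⟩
  · have : ∀ i, ((match f i with | .AB => 1 | .AC => 0) +
        (match f i with | .AB => 0 | .AC => 1) : ℕ) = 1 := fun i => by cases f i <;> rfl
    simp [this]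
  · intro NA ND h Ω _ P _ X hX m r s
    have hcount : ∀ (b : Bool) (i : Fin m), (Finset.univ.filter fun k =>
        ((pointList r s).get k).1 = i ∧ ((pointList r s).get k).2 = b).card =
        if b then r i else s i := by
      intro b i
      rw [← count_pointList, ← card_get_eq]
      congr 1
      ext k
      simp [Prod.ext_iff]
    -- The double sum is recognised as the number of monochromatic non-crossing partitions of the
    -- letters, which is the limit of the Wick expansion.
    rw [← card_isMono (isColoring_pointList r s) (r := r) (s := s) (hcount true) (hcount false), Int.cast_natCast,
      ← length_pointList]
    simp only [powProd_eq_wordProd]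
    exact tendsto_moment_word h hX _
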